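/- Let $n$ players have finite action sets $\mathcal A_k$ with $d_k=|\mathcal A_k|\ge 1$, and let $L>0$. There is $\eta_0>0$, depending only on $n$, $(d_k)_{k}$ and $L$, such that the following holds for every learning rate $0<\eta\le\eta_0$ and all integers $m,T\ge 1$. Let $\mathcal G^{(1)},\dots,\mathcal G^{(T)}$ be normal-form games between these players; $\Delta(\mathcal A_k)$ is the set of mixed strategies of player $k$, and in game $t$ the vector $u_k^{(t)}(x_{-k})\in\mathbb R^{d_k}$ lists the expected utilities of the actions of player $k$ against $x_{-k}$. Assume $\|u^{(t)}_k(x_{-k})-u^{(t)}_k(x'_{-k})\|_2\le L\|x_{-k}-x'_{-k}\|_2$ for all $t$, all $k$ and all mixed strategies. Each game is repeated for $m$ rounds; in round $i$ of game $t$ player $k$ plays $x_k^{(t,i)}$ and observes $u_k^{(t,i)}:=u^{(t)}_k(x^{(t,i)}_{-k})$, and $\|u_k^{(t,i)}\|_\infty\le 1$ for $1\le i\le m$. Each player $k$ uses the Blum–Mansour swap-regret reduction: for each action $a\in\mathcal A_k$ she runs a regret minimizer with strategies $x_a^{(t,i)}\in\Delta(\mathcal A_k)$, plays a stationary distribution $x_k^{(t,i)}$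 ($0\le i\le m$) of the Markov chain with transition probabilities $x_a^{(t,i)}$ out of $a$, and forwards $u_a^{(t,i)}:=x_k^{(t,i)}[a]\,u_k^{(t,i)}$ to the regret minimizer of $a$. The regret minimizers are optimistic mirror descent with the regularizer $\mathcal R_k(x)=-\sum_{a}\log x[a]$ and its Bregman divergence $\mathcal B_k(x\,\|\,y)=\mathcal R_k(x)-\mathcal R_k(y)-\langle\nabla\mathcal R_k(y),x-y\rangle$: with $\hat x_a^{(t,0)}=x_a^{(t,0)}$ and, for $1\le i\le m$ and $x$ ranging over the relative interior of $\Delta(\mathcal A_k)$, $$x_a^{(t,i)}=\arg\max_{x}\Big\{\langle x,u_a^{(t,i-1)}\rangle-\tfrac1\eta\mathcal B_k(x\,\|\,\hat x_a^{(t,i-1)})\Big\},\qquad \hat x_a^{(t,i)}=\arg\max_{x}\Big\{\langle x,u_a^{(t,i)}\rangle-\tfrac1\eta\mathcal B_k(x\,\|\,\hat x_a^{(t,i-1)})\Big\}.$$ Let $\mathring x_a^{(t)}\in\arg\max_{x\in\Delta(\mathcal A_k)}\sum_{i=1}^m\langle x,u_a^{(t,i)}\rangle$ be any optimum in hindsight,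 let $\alpha:=(mT)^{-1/3}$ and $\tilde x_a^{(t)}:=(1-\alpha)\mathring x_a^{(t)}+\frac{\alpha}{d_k}\mathbb 1$. The initializations are $x_a^{(1,0)}=\frac1{d_k}\mathbb 1$ and $x_a^{(t,0)}=\frac1{t-1}\sum_{s<t}\tilde x_a^{(s)}$ for $t\ge2$. Write $$B:=\frac1\eta\sum_{k=1}^n\sum_{a\in\mathcal A_k}\tilde V_{k,a}^2+\frac{m^{2/3}}{T^{1/3}}\Big(2n+\sum_{k=1}^n\frac{8d_k^3(1+\log T)}{\eta}\Big),$$ where $\tilde V_{k,a}^2:=\frac1T\sum_{t=1}^T\mathcal B_k(\tilde x_a^{(t)}\,\|\,\bar x_a)$ and $\bar x_a:=\frac1T\sum_{t=1}^T\tilde x_a^{(t)}$. Then: 1. For every player $k$, $\frac1T\sum_{t=1}^T\mathrm{SwapReg}_k^{(t,m)}\le B$, where $\mathrm{SwapReg}_k^{(t,m)}:=\max_\phi\sum_{i=1}^m\langle\phi(x_k^{(t,i)})-x_k^{(t,i)},u_k^{(t,i)}\rangle$ over all linear $\phi$ mapping $\Delta(\mathcal A_k)$ to itself. 2. Consequently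 the average play converges to correlated equilibria at the task-averaged rate $B/m$: there are $\epsilon_1,\dots,\epsilon_T$ with $\frac1T\sum_{t=1}^T\epsilon_t\le B/m$ such that, for each $t$, the average $\frac1m\sum_{i=1}^m x_1^{(t,i)}\otimes\cdots\otimes x_n^{(t,i)}$ of the product distributions played in game $t$ is an $\epsilon_t$-approximate correlated equilibrium of $\mathcal G^{(t)}$ (no player gains more than $\epsilon_t$ in expectation by any remapping $\mathcal A_k\to\mathcal A_k$ of her drawn action). -/

import Mathlib

namespace MetaSwap

/-! ### Normal-form games and their mixed extensions -/

/-- A normal-form game with players `Fin n`, where player `k` has the action set `Fin (d k)`: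
`u k a` is the utility of player `k` at the joint action profile `a`. -/
abbrev Game (n : ℕ) (d : Fin n → ℕ) : Type :=
  Fin n → ((j : Fin n) → Fin (d j)) → ℝ

/-- A family of vectors, one for each player; strategy profiles are those with
`x k ∈ stdSimplex ℝ (Fin (d k))` for all `k`. -/
abbrev Profile {n : ℕ} (d : Fin n → ℕ) : Type :=
  (k : Fin n) → Fin (d k) → ℝ

/-- Mixed extension of the utility of player `k`: its expectation when the players draw their
actions independently from `x 1, …, x n`. -/
def expUtil {n : ℕ} {d : Fin n → ℕ} (u : Game n d) (k : Fin n) (x : Profile d) : ℝ :=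
  ∑ a : (j : Fin n) → Fin (d j), (∏ j, x j (a j)) * u k a

/-- The utility vector `u_k(x_{-k})`: its entry at `b` is the expected utility of player `k`
when she plays the pure action `b` and the others play `x`.  It does not depend on `x k`. -/
def utilVec {n : ℕ} {d : Fin n → ℕ} (u : Game n d) (k : Fin n) (x : Profile d) :
    Fin (d k) → ℝ :=
  fun b => expUtil u k (Function.update x k (Pi.single b 1))

/-- `‖u_k(x_{-k}) - u_k(y_{-k})‖₂ ≤ L ‖x_{-k} - y_{-k}‖₂` for every player `k` and all
strategy profiles `x`, `y` (both sides squared; used with `0 < L`). -/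
def IsLipschitzGame {n : ℕ} {d : Fin n → ℕ} (u : Game n d) (L : ℝ) : Prop :=
  ∀ (k : Fin n) (x y : Profile d),
    (∀ j, x j ∈ stdSimplex ℝ (Fin (d j))) → (∀ j, y j ∈ stdSimplex ℝ (Fin (d j))) →
      ∑ b, (utilVec u k x b - utilVec u k y b) ^ 2 ≤
        L ^ 2 * ∑ j ∈ Finset.univ.erase k, ∑ b, (x j b - y j b) ^ 2

/-! ### Swap regret and correlated equilibria -/

/-- The values `∑_{i=1}^m ⟨φ(x⁽ⁱ⁾) - x⁽ⁱ⁾, u⁽ⁱ⁾⟩`, for all linear maps `φ` that map the simplex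
to itself. -/
def swapValues {D : ℕ} (m : ℕ) (x u : ℕ → Fin D → ℝ) : Set ℝ :=
  {r | ∃ φ : (Fin D → ℝ) →ₗ[ℝ] (Fin D → ℝ),
    Set.MapsTo φ (stdSimplex ℝ (Fin D)) (stdSimplex ℝ (Fin D)) ∧
      r = ∑ i ∈ Finset.Icc 1 m, (φ (x i) - x i) ⬝ᵥ u i}

/-- Swap regret after `m` rounds of the strategies `x` against the utility vectors `u`. -/
noncomputable def swapRegret {D : ℕ} (m : ℕ) (x u : ℕ → Fin D → ℝ) : ℝ :=
  sSup (swapValues m x u)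

/-- The supremum defining `swapRegret` is over a nonempty set. -/
theorem swapValues_nonempty {D : ℕ} (m : ℕ) (x u : ℕ → Fin D → ℝ) :
    (swapValues m x u).Nonempty :=
  ⟨_, LinearMap.id, fun _ h => h, rfl⟩

/-- For strategies in the simplex, the supremum defining `swapRegret` is over a bounded set. -/
theorem swapValues_bddAbove {D : ℕ} (m : ℕ) (x u : ℕ → Fin D → ℝ)
    (hx : ∀ i ∈ Finset.Icc 1 m, x i ∈ stdSimplex ℝ (Fin D)) :
    BddAbove (swapValues m x u) := by
  refine ⟨∑ i ∈ Finset.Icc 1 m, (∑ b, |u i b| - x i ⬝ᵥ u i), ?_⟩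
  rintro r ⟨φ, hφ, rfl⟩
  refine Finset.sum_le_sum fun i hi => ?_
  rw [sub_dotProduct]
  refine sub_le_sub_right (Finset.sum_le_sum fun b _ => ?_) _
  have h := hφ (hx i hi)
  have h0 : 0 ≤ φ (x i) b := h.1 b
  have h1 : φ (x i) b ≤ 1 := by
    rw [← h.2]
    exact Finset.single_le_sum (f := fun b => φ (x i) b) (fun b _ => h.1 b) (Finset.mem_univ b)
  calc φ (x i) b * u i b ≤ φ (x i) b * |u i b| :=
        mul_le_mul_of_nonneg_left (le_abs_self _) h0
    _ ≤ 1 * |u i b| := mul_le_mul_of_nonneg_right h1 (abs_nonneg _)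
    _ = |u i b| := one_mul _

/-- The average correlated distribution of play over `m` rounds: the uniform mixture of the
product distributions `x⁽¹⁾, …, x⁽ᵐ⁾`. -/
noncomputable def avgPlay {n : ℕ} {d : Fin n → ℕ} (m : ℕ) (x : ℕ → Profile d)
    (a : (j : Fin n) → Fin (d j)) : ℝ :=
  (1 / (m : ℝ)) * ∑ i ∈ Finset.Icc 1 m, ∏ j, x i j (a j)

/-- `μ` is an `ε`-approximate correlated equilibrium: no player can gain more than `ε` in
expectation by any remapping `φ` of her recommended actions. -/
def IsApproxCE {n : ℕ} {d : Fin n → ℕ} (u : Game n d) (ε : ℝ)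
    (μ : ((j : Fin n) → Fin (d j)) → ℝ) : Prop :=
  ∀ (k : Fin n) (φ : Fin (d k) → Fin (d k)),
    ∑ a, μ a * u k (Function.update a k (φ (a k))) ≤ ∑ a, μ a * u k a + ε

/-! ### Optimistic mirror descent with the logarithmic barrier -/

/-- The relative interior of the simplex, which is the domain of the logarithmic barrier
(the barrier is `+∞` on the rest of the simplex). -/
def openSimplex (D : ℕ) : Set (Fin D → ℝ) :=
  {x | (∀ a, 0 < x a) ∧ ∑ a, x a = 1}

/-- The logarithmic regularizer `x ↦ -∑ₐ log x[a]`. -/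
noncomputable def logBarrier {D : ℕ} (x : Fin D → ℝ) : ℝ :=
  -∑ a, Real.log (x a)

/-- Bregman divergence of the logarithmic regularizer:
`R(x) - R(y) - ⟨∇R(y), x - y⟩`. -/
noncomputable def bregman {D : ℕ} (x y : Fin D → ℝ) : ℝ :=
  logBarrier x - logBarrier y - fderiv ℝ logBarrier y (x - y)

/-- `x` is the proximal step with learning rate `η` from `y` along `v`:
`x = argmax_z {⟨z, v⟩ - (1/η) D(z ‖ y)}`. -/
def IsProxStep {D : ℕ} (η : ℝ) (y v x : Fin D → ℝ) : Prop :=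
  x ∈ openSimplex D ∧
    IsMaxOn (fun z => z ⬝ᵥ v - (1 / η) * bregman z y) (openSimplex D) x

/-- Optimistic mirror descent over `m` rounds, initialized at `x₀`, with predictions `p⁽ⁱ⁾`,
observed utilities `u⁽ⁱ⁾`, strategies `x⁽ⁱ⁾` and secondary iterates `y⁽ⁱ⁾`. -/
structure IsOMD {D : ℕ} (m : ℕ) (η : ℝ) (x₀ : Fin D → ℝ) (p u x y : ℕ → Fin D → ℝ) :
    Prop where
  init_x : x 0 = x₀
  init_y : y 0 = x₀
  step_x : ∀ i ∈ Finset.Icc 1 m, IsProxStep η (y (i - 1)) (p i) (x i)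
  step_y : ∀ i ∈ Finset.Icc 1 m, IsProxStep η (y (i - 1)) (u i) (y i)

/-! ### The Blum--Mansour reduction with meta-learned initialization -/

/-- `x` is a stationary distribution of the Markov chain whose transition probabilities out of
the state `a` are `Q a`. -/
def IsStationary {D : ℕ} (Q : Fin D → Fin D → ℝ) (x : Fin D → ℝ) : Prop :=
  x ∈ stdSimplex ℝ (Fin D) ∧ ∀ b, ∑ a, x a * Q a b = x b

/-- `x` is an optimum in hindsight: it maximizes `z ↦ ∑_{i=1}^m ⟨z, u⁽ⁱ⁾⟩` on the simplex. -/
def IsOptInHindsight {D : ℕ} (m : ℕ) (u : ℕ → Fin D → ℝ) (x : Fin D → ℝ) : Prop :=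
  x ∈ stdSimplex ℝ (Fin D) ∧
    IsMaxOn (fun z => ∑ i ∈ Finset.Icc 1 m, z ⬝ᵥ u i) (stdSimplex ℝ (Fin D)) x

/-- The shift `(1 - α) x + α (1/D) 𝟙` towards the uniform distribution. -/
noncomputable def shift {D : ℕ} (α : ℝ) (x : Fin D → ℝ) : Fin D → ℝ :=
  fun b => (1 - α) * x b + α * (1 / (D : ℝ))

/-- The average of the first `N` points `z 1, …, z N`. -/
noncomputable def average {D : ℕ} (N : ℕ) (z : ℕ → Fin D → ℝ) : Fin D → ℝ :=
  fun b => (1 / (N : ℝ)) * ∑ s ∈ Finset.Icc 1 N, z s b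

/-- Everything that is produced in a sequence of repeated games.  Tasks are `t = 1, 2, …`,
rounds of a task are `i = 1, 2, …`, and `i = 0` is the initialization. -/
structure Trajectory (n : ℕ) (d : Fin n → ℕ) where
  /-- strategy of player `k` in round `i` of task `t` -/
  play : ℕ → ℕ → Profile d
  /-- strategy of the regret minimizer of player `k` for the action `a` -/
  base : ℕ → ℕ → (k : Fin n) → Fin (d k) → Fin (d k) → ℝ
  /-- secondary iterate of the regret minimizer of player `k` for the action `a` -/
  sec : ℕ → ℕ → (k : Fin n) → Fin (d k) → Fin (d k) → ℝ
  /-- optimum in hindsight, in task `t`, of the regret minimizer of player `k` for `a` -/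
  opt : ℕ → (k : Fin n) → Fin (d k) → Fin (d k) → ℝ

variable {n : ℕ} {d : Fin n → ℕ}

/-- The utility vector `x_k⁽ᵗⁱ⁾[a] u_k⁽ᵗⁱ⁾` forwarded to the regret minimizer for `a`. -/
def Trajectory.fwd (R : Trajectory n d) (G : ℕ → Game n d) (t i : ℕ) (k : Fin n)
    (a : Fin (d k)) : Fin (d k) → ℝ :=
  R.play t i k a • utilVec (G t) k (R.play t i)

/-- The shifted optimum in hindsight of task `t`. -/
noncomputable def Trajectory.shiftedOpt (R : Trajectory n d) (α : ℝ) (k : Fin n)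
    (a : Fin (d k)) (t : ℕ) : Fin (d k) → ℝ :=
  shift α (R.opt t k a)

/-- The initialization in task `t`: the uniform distribution (the minimizer of the logarithmic
regularizer) in the first task, and then the average of the shifted optima in hindsight of all
previous tasks. -/
noncomputable def Trajectory.init (R : Trajectory n d) (α : ℝ) (t : ℕ) (k : Fin n)
    (a : Fin (d k)) : Fin (d k) → ℝ :=
  if t ≤ 1 then fun _ => 1 / (d k : ℝ) else average (t - 1) (R.shiftedOpt α k a)

/-- All players run the Blum--Mansour reduction in each of the `T` games `G 1, …, G T`, for `m`
rounds each, with a log-barrier OMD regret minimizer for each action; the prediction is the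
previously forwarded utility, where the one before the first round is that of the initial
strategies. -/
structure IsMetaRun (G : ℕ → Game n d) (m T : ℕ) (η α : ℝ) (R : Trajectory n d) : Prop where
  omd : ∀ t ∈ Finset.Icc 1 T, ∀ (k : Fin n) (a : Fin (d k)),
    IsOMD m η (R.init α t k a) (fun i => R.fwd G t (i - 1) k a) (fun i => R.fwd G t i k a)
      (fun i => R.base t i k a) (fun i => R.sec t i k a)
  stationary : ∀ t ∈ Finset.Icc 1 T, ∀ i ∈ Finset.Icc 0 m, ∀ k : Fin n,
    IsStationary (R.base t i k) (R.play t i k)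
  opt : ∀ t ∈ Finset.Icc 1 T, ∀ (k : Fin n) (a : Fin (d k)),
    IsOptInHindsight m (fun i => R.fwd G t i k a) (R.opt t k a)

/-- Swap regret of player `k` in task `t`. -/
noncomputable def Trajectory.swapReg (R : Trajectory n d) (G : ℕ → Game n d) (m t : ℕ)
    (k : Fin n) : ℝ :=
  swapRegret m (fun i => R.play t i k) (fun i => utilVec (G t) k (R.play t i))

/-- The task similarity `Ṽ²_{k,a}`: the average Bregman divergence of the shifted optima in
hindsight from their mean. -/
noncomputable def Trajectory.similarity (R : Trajectory n d) (T : ℕ) (α : ℝ) (k : Fin n)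
    (a : Fin (d k)) : ℝ :=
  (1 / (T : ℝ)) * ∑ t ∈ Finset.Icc 1 T,
    bregman (R.shiftedOpt α k a t) (average T (R.shiftedOpt α k a))

/-- The bound on the task-averaged swap regret. -/
noncomputable def Trajectory.regretBound (R : Trajectory n d) (m T : ℕ) (η α : ℝ) : ℝ :=
  (1 / η) * ∑ k, ∑ a, R.similarity T α k a +
    (m : ℝ) ^ (2 / 3 : ℝ) / (T : ℝ) ^ (1 / 3 : ℝ) *
      (2 * (n : ℝ) + ∑ k, 8 * (d k : ℝ) ^ 3 * (1 + Real.log T) / η)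

end MetaSwap

namespace MetaSwap

/-! ### The Bregman divergence of the logarithmic barrier -/

/-! A swap deviation assigns to each action `a` the fixed comparator `φ(e_a)`, and stationarity
writes the play as the mixture of the base strategies. Swap regret is therefore at most the sum of
the base regrets (`swapRegret_le_sum`). Replacing the hindsight optima by their shifts costs `2αm`
(`sum_shift_le`).

Within one game, optimistic mirror descent bounds the base regrets by the initial divergence over
`η`, plus `η` times the variation of utilities and play, minus `1/(2η)` times the divergences
between consecutive iterates (`IsBMRun.regret_le`). The Lipschitz condition turns variation of
utilities into variation of play. The log barrier makes steps small in ratio, and multiplicative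
perturbations of a Markov chain move its stationary distribution by a comparable factor
(`IsStationary.sum_sq_sub_le`). So the variation of play is at most a constant times those
divergences (`IsBMRun.path_le`), and for small `η` the negative terms cancel it once all players are
summed (`IsMetaRun.sum_swapReg_le`). Swap regret is nonnegative, so the bound on the sum holds for
each player.

Across games only the initial divergences remain. Their best fixed reference point is the mean, and
following the running average loses `O(1/(α² t))` in task `t`, a harmonic sum
(`sum_bregman_followAverage_le`). The choice `α = (mT)^(-1/3)` balances this loss against the cost
of the shift. -/

theorem hasFDerivAt_logBarrier {D : ℕ} {y : Fin D → ℝ} (hy : ∀ b, 0 < y b) :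
    HasFDerivAt (logBarrier (D := D))
      (-∑ b, (y b)⁻¹ • (ContinuousLinearMap.proj b : (Fin D → ℝ) →L[ℝ] ℝ)) y := by
  unfold logBarrier
  refine (HasFDerivAt.fun_sum fun b _ => ?_).neg
  exact (hasFDerivAt_apply b y).log (hy b).ne'

theorem fderiv_logBarrier {D : ℕ} {y : Fin D → ℝ} (hy : ∀ b, 0 < y b) (v : Fin D → ℝ) :
    fderiv ℝ logBarrier y v = -∑ b, (y b)⁻¹ * v b := by
  rw [(hasFDerivAt_logBarrier hy).fderiv]
  simp

theorem bregman_eq {D : ℕ} {x y : Fin D → ℝ} (hx : ∀ b, 0 < x b) (hy : ∀ b, 0 < y b) :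
    bregman x y = ∑ b, (x b / y b - 1 - Real.log (x b / y b)) := by
  rw [bregman, fderiv_logBarrier hy, logBarrier, logBarrier, neg_sub_neg, sub_neg_eq_add,
    ← Finset.sum_sub_distrib, ← Finset.sum_add_distrib]
  refine Finset.sum_congr rfl fun b _ => ?_
  have h1 := (hy b).ne'
  rw [Real.log_div (hx b).ne' h1, Pi.sub_apply]
  field_simp
  ring

theorem sub_one_sub_log_nonneg {s : ℝ} (hs : 0 < s) : 0 ≤ s - 1 - Real.log s := by
  linarith [Real.log_le_sub_one_of_pos hs]

/-- From `log s = 2 log √s ≤ 2(√s - 1)` the right-hand gap is at least `(√s - 1)²`; the remaining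
factor `(√s + 1)²` is at most `(1 + √2)² < 6`. -/
theorem sq_sub_one_le {s : ℝ} (hs : 0 < s) (h2 : s ≤ 2) :
    (s - 1) ^ 2 ≤ 6 * (s - 1 - Real.log s) := by
  have hr : 0 < √s := Real.sqrt_pos.2 hs
  have hsq : √s ^ 2 = s := Real.sq_sqrt hs.le
  have hlog : Real.log s ≤ 2 * (√s - 1) := by
    have h := Real.log_le_sub_one_of_pos hr
    rw [Real.log_sqrt hs.le] at h
    linarith
  have h1 : (√s - 1) ^ 2 ≤ s - 1 - Real.log s := by nlinarith
  have h3 : (√s + 1) ^ 2 ≤ 6 := by nlinarith [sq_nonneg (√s - 1)]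
  calc (s - 1) ^ 2 = (√s + 1) ^ 2 * (√s - 1) ^ 2 := by
        rw [← mul_pow, ← hsq]
        ring_nf
        rw [Real.sqrt_sq hr.le]
    _ ≤ 6 * (√s - 1) ^ 2 := by gcongr
    _ ≤ _ := by gcongr

theorem bregman_nonneg {D : ℕ} {x y : Fin D → ℝ} (hx : ∀ b, 0 < x b) (hy : ∀ b, 0 < y b) :
    0 ≤ bregman x y := by
  rw [bregman_eq hx hy]
  exact Finset.sum_nonneg fun b _ => sub_one_sub_log_nonneg (div_pos (hx b) (hy b))

theorem bregman_self {D : ℕ} {x : Fin D → ℝ} : bregman x x = 0 := by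
  simp [bregman]

/-- The squared local norm of `x - y` at `y` is controlled by the divergence. -/
theorem sum_sq_div_sub_one_le {D : ℕ} {x y : Fin D → ℝ} (hx : ∀ b, 0 < x b)
    (hy : ∀ b, 0 < y b) (h2 : ∀ b, x b / y b ≤ 2) :
    ∑ b, (x b / y b - 1) ^ 2 ≤ 6 * bregman x y := by
  rw [bregman_eq hx hy, Finset.mul_sum]
  exact Finset.sum_le_sum fun b _ => sq_sub_one_le (div_pos (hx b) (hy b)) (h2 b)

/-! ### Proximal steps -/

/-- Lagrange condition for the constraint `∑ x = 1`: the maximizer is interior, so the derivative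
along each direction `e_b - e_{b₀}` vanishes. -/
theorem IsProxStep.exists_multiplier {D : ℕ} {η : ℝ} {y v x : Fin D → ℝ}
    (h : IsProxStep η y v x) (hy : ∀ b, 0 < y b) :
    ∃ c : ℝ, ∀ b, v b = c + (1 / η) * (1 / y b - 1 / x b) := by
  rcases isEmpty_or_nonempty (Fin D) with hE | ⟨⟨b₀⟩⟩
  · exact ⟨0, fun b => hE.elim b⟩
  obtain ⟨⟨hx, hx1⟩, hmax⟩ := h
  refine ⟨v b₀ - (1 / η) * (1 / y b₀ - 1 / x b₀), fun b => ?_⟩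
  set w : Fin D → ℝ := Pi.single b 1 - Pi.single b₀ 1 with hw
  have hwsum : ∑ c, w c = 0 := by simp [hw, Finset.sum_sub_distrib]
  set f : (Fin D → ℝ) → ℝ := fun z => z ⬝ᵥ v - (1 / η) * bregman z y with hf
  have hline : HasDerivAt (fun s : ℝ => x + s • w) w 0 := by
    simpa using ((hasDerivAt_id (0 : ℝ)).smul_const w).const_add x
  have hlin : HasDerivAt (fun s : ℝ => (x + s • w) ⬝ᵥ v) (w ⬝ᵥ v) 0 := by
    have : HasDerivAt (fun s : ℝ => x ⬝ᵥ v + s * (w ⬝ᵥ v)) (1 * (w ⬝ᵥ v)) 0 :=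
      ((hasDerivAt_id (0 : ℝ)).mul_const _).const_add _
    simpa [add_dotProduct, smul_dotProduct] using this
  have hbar : HasDerivAt (fun s : ℝ => logBarrier (x + s • w)) (-∑ c, (x c)⁻¹ * w c) 0 := by
    have h0 : HasFDerivAt (logBarrier (D := D))
      (-∑ b, (x b)⁻¹ • (ContinuousLinearMap.proj b : (Fin D → ℝ) →L[ℝ] ℝ)) (x + (0 : ℝ) • w) := by
      simpa using hasFDerivAt_logBarrier hx
    have := h0.comp_hasDerivAt (0 : ℝ) hline
    simpa [Function.comp_def] using this
  have hgrad : HasDerivAt (fun s : ℝ => fderiv ℝ logBarrier y (x + s • w - y))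
      (-∑ c, (y c)⁻¹ * w c) 0 := by
    have := (fderiv ℝ logBarrier y).hasFDerivAt.comp_hasDerivAt (0 : ℝ) (hline.sub_const y)
    rw [fderiv_logBarrier hy] at this
    simpa [Function.comp_def] using this
  have hder := hlin.sub ((((hbar.sub_const (logBarrier y)).sub hgrad)).const_mul (1 / η))
  have hloc : IsLocalMax (fun s : ℝ => f (x + s • w)) 0 := by
    have hpos : ∀ᶠ s : ℝ in nhds 0, ∀ c, 0 < (x + s • w) c := by
      refine Filter.eventually_all.2 fun c => ?_
      have hc : ContinuousAt (fun s : ℝ => (x + s • w) c) 0 := by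
        simp only [Pi.add_apply, Pi.smul_apply, smul_eq_mul]
        fun_prop
      exact hc.eventually_const_lt (by simpa using hx c)
    filter_upwards [hpos] with s hs
    have hmem : x + s • w ∈ openSimplex D := by
      refine ⟨hs, ?_⟩
      simp [Finset.sum_add_distrib, ← Finset.mul_sum, hwsum, hx1]
    simpa [hf] using hmax hmem
  have hzero := hloc.hasDerivAt_eq_zero hder
  have e1 : w ⬝ᵥ v = v b - v b₀ := by simp [hw, sub_dotProduct]
  have e2 : ∀ z : Fin D → ℝ, ∑ c, (z c)⁻¹ * w c = (z b)⁻¹ - (z b₀)⁻¹ := by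
    intro z
    simp [hw, mul_sub, Finset.sum_sub_distrib, Pi.single_apply]
  rw [e1, e2, e2] at hzero
  simp only [one_div] at hzero ⊢
  linarith

/-- An equality rather than the usual inequality because the maximizer is interior. The multiplier
drops out since `z - x` sums to zero. -/
theorem IsProxStep.three_point {D : ℕ} {η : ℝ} {y v x z : Fin D → ℝ}
    (h : IsProxStep η y v x) (hy : ∀ b, 0 < y b) (hz : z ∈ openSimplex D) :
    (z - x) ⬝ᵥ v = (1 / η) * (bregman z y - bregman z x - bregman x y) := by
  obtain ⟨c, hc⟩ := h.exists_multiplier hy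
  obtain ⟨⟨hx, hx1⟩, -⟩ := h
  have h0 : ∑ b, c * (z b - x b) = 0 := by
    rw [← Finset.mul_sum, Finset.sum_sub_distrib, hz.2, hx1, sub_self, mul_zero]
  rw [bregman_eq hz.1 hy, bregman_eq hz.1 hx, bregman_eq hx hy, ← Finset.sum_sub_distrib,
    ← Finset.sum_sub_distrib, Finset.mul_sum, ← add_zero (∑ b, 1 / η * _), ← h0,
    ← Finset.sum_add_distrib]
  refine Finset.sum_congr rfl fun b _ => ?_
  have h1 := (hx b).ne'
  have h2 := (hy b).ne'
  have h3 := (hz.1 b).ne'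
  rw [Real.log_div h3 h2, Real.log_div h3 h1, Real.log_div h1 h2, Pi.sub_apply, hc b]
  have : z b / y b - 1 - (Real.log (z b) - Real.log (y b)) -
      (z b / x b - 1 - (Real.log (z b) - Real.log (x b))) -
      (x b / y b - 1 - (Real.log (x b) - Real.log (y b))) =
      (z b - x b) * (1 / y b - 1 / x b) := by
    field_simp
    ring
  rw [this]
  ring

/-- Multiplicative stability of a proximal step. -/
theorem IsProxStep.abs_div_sub_one_le {D : ℕ} {η C : ℝ} {y v x : Fin D → ℝ}
    (h : IsProxStep η y v x) (hη : 0 < η) (hy : y ∈ openSimplex D) (hv : ∀ b, |v b| ≤ C)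
    (b : Fin D) : |y b / x b - 1| ≤ 2 * η * C := by
  obtain ⟨c, hc⟩ := h.exists_multiplier hy.1
  obtain ⟨⟨hx, hx1⟩, -⟩ := h
  have hne : (Finset.univ : Finset (Fin D)).Nonempty := ⟨b, Finset.mem_univ b⟩
  have hkey : ∀ b, η * (v b - c) = 1 / y b - 1 / x b := by
    intro b
    rw [hc b]
    field_simp
    ring
  -- If the multiplier left `[-C, C]`, all coordinates would move in the same direction, although
  -- `x` and `y` both sum to one.
  have hcu : c ≤ C := by
    by_contra! hlt
    have : ∑ b, x b < ∑ b, y b := by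
      refine Finset.sum_lt_sum_of_nonempty hne fun b _ => ?_
      refine (one_div_lt_one_div (hy.1 b) (hx b)).1 ?_
      have := hkey b
      have h2 : v b < c := (le_abs_self _).trans_lt ((hv b).trans_lt hlt)
      nlinarith
    rw [hx1, hy.2] at this
    exact lt_irrefl _ this
  have hcl : -C ≤ c := by
    by_contra! hlt
    have : ∑ b, y b < ∑ b, x b := by
      refine Finset.sum_lt_sum_of_nonempty hne fun b _ => ?_
      refine (one_div_lt_one_div (hx b) (hy.1 b)).1 ?_
      have := hkey b
      have h2 : c < v b := hlt.trans_le (by linarith [neg_abs_le (v b), hv b])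
      nlinarith
    rw [hx1, hy.2] at this
    exact lt_irrefl _ this
  have hy1 : y b ≤ 1 := by
    rw [← hy.2]
    exact Finset.single_le_sum (f := y) (fun b _ => (hy.1 b).le) (Finset.mem_univ b)
  have heq : y b / x b - 1 = -(η * (v b - c) * y b) := by
    rw [hkey b]
    have h1 := (hx b).ne'
    have h2 := (hy.1 b).ne'
    field_simp
    ring
  have hvc : |v b - c| ≤ 2 * C := by
    have := abs_le.1 (hv b)
    rw [abs_le]
    constructor <;> linarith
  rw [heq, abs_neg, abs_mul, abs_mul, abs_of_pos hη, abs_of_pos (hy.1 b)]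
  calc η * |v b - c| * y b ≤ η * (2 * C) * 1 := by
        have : 0 ≤ 2 * C := (abs_nonneg _).trans hvc
        have := (hy.1 b).le
        gcongr
    _ = 2 * η * C := by ring

/-! ### Regret of optimistic mirror descent -/

theorem IsOMD.sec_mem {D m : ℕ} {η : ℝ} {x₀ : Fin D → ℝ} {p u x y : ℕ → Fin D → ℝ}
    (h : IsOMD m η x₀ p u x y) (h0 : x₀ ∈ openSimplex D) {i : ℕ} (hi : i ≤ m) :
    y i ∈ openSimplex D := by
  rcases Nat.eq_zero_or_pos i with rfl | hpos
  · rwa [h.init_y]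
  · exact (h.step_y i (Finset.mem_Icc.2 ⟨hpos, hi⟩)).1

theorem IsOMD.base_mem {D m : ℕ} {η : ℝ} {x₀ : Fin D → ℝ} {p u x y : ℕ → Fin D → ℝ}
    (h : IsOMD m η x₀ p u x y) (h0 : x₀ ∈ openSimplex D) {i : ℕ} (hi : i ≤ m) :
    x i ∈ openSimplex D := by
  rcases Nat.eq_zero_or_pos i with rfl | hpos
  · rwa [h.init_x]
  · exact (h.step_x i (Finset.mem_Icc.2 ⟨hpos, hi⟩)).1

/-- Split `z - x i` at `y i` and `u i` at `p i`. The three-point identities for both steps cancel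
`bregman (y i) (y (i - 1))`, and the divergences from `z` telescope. -/
theorem IsOMD.regret_le {D m : ℕ} {η : ℝ} {x₀ z : Fin D → ℝ} {p u x y : ℕ → Fin D → ℝ}
    (h : IsOMD m η x₀ p u x y) (hη : 0 < η) (h0 : x₀ ∈ openSimplex D)
    (hz : z ∈ openSimplex D) :
    ∑ i ∈ Finset.Icc 1 m, (z - x i) ⬝ᵥ u i ≤ (1 / η) * bregman z x₀ +
      ∑ i ∈ Finset.Icc 1 m, ((y i - x i) ⬝ᵥ (u i - p i) -
        (1 / η) * (bregman (y i) (x i) + bregman (x i) (y (i - 1)))) := by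
  have hind : ∀ N ≤ m, ∑ i ∈ Finset.Icc 1 N, (z - x i) ⬝ᵥ u i =
      (1 / η) * bregman z x₀ - (1 / η) * bregman z (y N) +
      ∑ i ∈ Finset.Icc 1 N, ((y i - x i) ⬝ᵥ (u i - p i) -
        (1 / η) * (bregman (y i) (x i) + bregman (x i) (y (i - 1)))) := by
    intro N
    induction N with
    | zero => intro _; simp [h.init_y]
    | succ N ih =>
      intro hN
      have hmem : N + 1 ∈ Finset.Icc 1 m := Finset.mem_Icc.2 ⟨by omega, hN⟩
      have hyN := (h.sec_mem h0 (i := N) (by omega)).1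
      rw [Finset.sum_Icc_succ_top (by omega), Finset.sum_Icc_succ_top (by omega), ih (by omega)]
      have e1 := (h.step_y _ hmem).three_point (by simpa using hyN) hz
      have e2 := (h.step_x _ hmem).three_point (by simpa using hyN) (h.step_y _ hmem).1
      simp only [Nat.add_sub_cancel, sub_dotProduct, dotProduct_sub] at e1 e2 ⊢
      linarith
  rw [hind m le_rfl]
  have := bregman_nonneg hz.1 (h.sec_mem h0 le_rfl).1
  have : 0 ≤ (1 / η) * bregman z (y m) := by positivity
  linarith

/-! ### Multiplicative stability of stationary distributions -/

theorem IsStationary.pos {D : ℕ} {Q : Fin D → Fin D → ℝ} {x : Fin D → ℝ}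
    (h : IsStationary Q x) (hQ : ∀ a b, 0 < Q a b) (b : Fin D) : 0 < x b := by
  obtain ⟨⟨hx0, hx1⟩, hst⟩ := h
  rw [← hst b]
  obtain ⟨a, -, ha⟩ : ∃ a ∈ (Finset.univ : Finset (Fin D)), 0 < x a :=
    Finset.exists_lt_of_sum_lt (by simp [hx1])
  exact Finset.sum_pos' (fun c _ => mul_nonneg (hx0 c) (hQ c b).le)
    ⟨a, Finset.mem_univ a, mul_pos ha (hQ a b)⟩

/-- In the stationary regime, the flow out of a set of states equals the flow into it. -/
theorem IsStationary.flow_eq {D : ℕ} {Q : Fin D → Fin D → ℝ} {x : Fin D → ℝ}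
    (h : IsStationary Q x) (hQ : ∀ a, ∑ b, Q a b = 1) (S : Finset (Fin D)) :
    ∑ a ∈ S, ∑ b ∈ Sᶜ, x a * Q a b = ∑ a ∈ Sᶜ, ∑ b ∈ S, x a * Q a b := by
  have h1 : ∑ a ∈ S, x a = ∑ a ∈ S, ∑ b ∈ S, x a * Q a b + ∑ a ∈ S, ∑ b ∈ Sᶜ, x a * Q a b := by
    rw [← Finset.sum_add_distrib]
    refine Finset.sum_congr rfl fun a _ => ?_
    rw [Finset.sum_add_sum_compl, ← Finset.mul_sum, hQ, mul_one]
  have h2 : ∑ b ∈ S, x b = ∑ a ∈ S, ∑ b ∈ S, x a * Q a b + ∑ a ∈ Sᶜ, ∑ b ∈ S, x a * Q a b := by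
    rw [Finset.sum_add_sum_compl S (fun a => ∑ b ∈ S, x a * Q a b), Finset.sum_comm]
    exact Finset.sum_congr rfl fun b _ => (h.2 b).symm
  linarith

/-- If the ratios `x' / x` are at most `M` outside `S`, then one of them is at most `ρ M` in `S`. -/
theorem exists_ratio_le {D : ℕ} {Q Q' : Fin D → Fin D → ℝ} {x x' : Fin D → ℝ}
    (h : IsStationary Q x) (h' : IsStationary Q' x') (hQ : ∀ a b, 0 < Q a b)
    (hQ1 : ∀ a, ∑ b, Q a b = 1) (hQ1' : ∀ a, ∑ b, Q' a b = 1) {ε M : ℝ} (hε : ε < 1)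
    (hlow : ∀ a b, (1 - ε) * Q a b ≤ Q' a b) (hup : ∀ a b, Q' a b ≤ (1 + ε) * Q a b)
    {S : Finset (Fin D)} (hS : S.Nonempty) (hS' : Sᶜ.Nonempty)
    (hM : ∀ b ∈ Sᶜ, x' b ≤ M * x b) :
    ∃ b ∈ S, x' b ≤ (1 + ε) / (1 - ε) * M * x b := by
  by_contra! hcon
  have hx := h.pos hQ
  have hε' : 0 < 1 - ε := by linarith
  have hQ' : ∀ a b, 0 < Q' a b := fun a b => (mul_pos hε' (hQ a b)).trans_le (hlow a b)
  have hx' := h'.pos hQ'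
  obtain ⟨c, hc⟩ := hS'
  have hM0 : 0 < M := by
    have := (hx' c).trans_le (hM c hc)
    exact pos_of_mul_pos_left this (hx c).le
  -- If every ratio in `S` exceeded the claimed bound, the new flow out of `S` would be more than
  -- `(1 + ε) M` times the old one, while the new flow into `S` is at most that multiple. In both
  -- chains the two flows balance.
  have h1 : (1 + ε) * M * ∑ a ∈ S, ∑ b ∈ Sᶜ, x a * Q a b < ∑ a ∈ S, ∑ b ∈ Sᶜ, x' a * Q' a b := by
    rw [Finset.mul_sum]
    refine Finset.sum_lt_sum_of_nonempty hS fun a ha => ?_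
    rw [Finset.mul_sum]
    refine Finset.sum_lt_sum_of_nonempty ⟨c, hc⟩ fun b _ => ?_
    have e : (1 + ε) * M * (x a * Q a b) =
        ((1 + ε) / (1 - ε) * M * x a) * ((1 - ε) * Q a b) := by
      field_simp
    rw [e]
    exact mul_lt_mul (hcon a ha) (hlow a b) (mul_pos hε' (hQ a b)) (hx' a).le
  have h2 : ∑ a ∈ Sᶜ, ∑ b ∈ S, x' a * Q' a b ≤ (1 + ε) * M * ∑ a ∈ Sᶜ, ∑ b ∈ S, x a * Q a b := by
    rw [Finset.mul_sum]
    refine Finset.sum_le_sum fun a ha => ?_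
    rw [Finset.mul_sum]
    refine Finset.sum_le_sum fun b _ => ?_
    have e : (1 + ε) * M * (x a * Q a b) = (M * x a) * ((1 + ε) * Q a b) := by ring
    rw [e]
    exact mul_le_mul (hM a ha) (hup a b) (hQ' a b).le (mul_nonneg hM0.le (hx a).le)
  rw [h.flow_eq hQ1, h'.flow_eq hQ1'] at h1
  exact absurd (h1.trans_le h2) (lt_irrefl _)

/-- Multiplicative perturbations of the transition probabilities by `1 ± ε` perturb the
stationary distribution by a factor of at most `((1 + ε) / (1 - ε)) ^ D`. -/
theorem IsStationary.ratio_le {D : ℕ} {Q Q' : Fin D → Fin D → ℝ} {x x' : Fin D → ℝ}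
    (h : IsStationary Q x) (h' : IsStationary Q' x') (hQ : ∀ a b, 0 < Q a b)
    (hQ1 : ∀ a, ∑ b, Q a b = 1) (hQ1' : ∀ a, ∑ b, Q' a b = 1) {ε : ℝ} (hε0 : 0 ≤ ε) (hε : ε < 1)
    (hlow : ∀ a b, (1 - ε) * Q a b ≤ Q' a b) (hup : ∀ a b, Q' a b ≤ (1 + ε) * Q a b)
    (b c : Fin D) : x' b * x c ≤ ((1 + ε) / (1 - ε)) ^ D * (x' c * x b) := by
  have hx := h.pos hQ
  have hε' : 0 < 1 - ε := by linarith
  have hQ' : ∀ a b, 0 < Q' a b := fun a b => (mul_pos hε' (hQ a b)).trans_le (hlow a b)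
  have hx' := h'.pos hQ'
  set ρ := (1 + ε) / (1 - ε) with hρ
  have hρ1 : 1 ≤ ρ := by rw [hρ, one_le_div hε']; linarith
  -- States whose ratio is within `ρ ^ j` of the ratio at `c`. Applying `exists_ratio_le` to the
  -- complement adds at least one state per step, so all `D` states are reached by `j = D`.
  let A : ℕ → Finset (Fin D) := fun j =>
    Finset.univ.filter fun e => x' e ≤ ρ ^ j * (x' c / x c) * x e
  have hr : 0 < x' c / x c := div_pos (hx' c) (hx c)
  have hcmem : ∀ j, c ∈ A j := by
    intro j
    simp only [A, Finset.mem_filter, Finset.mem_univ, true_and]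
    rw [mul_assoc, div_mul_cancel₀ _ (hx c).ne']
    exact le_mul_of_one_le_left (hx' c).le (one_le_pow₀ hρ1)
  have hmono : ∀ j, A j ⊆ A (j + 1) := by
    intro j e he
    simp only [A, Finset.mem_filter, Finset.mem_univ, true_and] at he ⊢
    refine he.trans ?_
    have := (hx e).le
    gcongr ?_ * _ * _
    exact pow_le_pow_right₀ hρ1 j.le_succ
  have hcard : ∀ j, A j = Finset.univ ∨ j < (A j).card := by
    intro j
    induction j with
    | zero => exact Or.inr (Finset.card_pos.2 ⟨c, hcmem 0⟩)
    | succ j ih =>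
      by_cases hu : A j = Finset.univ
      · exact Or.inl (Finset.eq_univ_of_forall fun e => hmono j (by rw [hu]; exact Finset.mem_univ e))
      · have hlt := ih.resolve_left hu
        right
        have hne : ((A j)ᶜ).Nonempty := by
          rw [Finset.nonempty_iff_ne_empty]
          simpa [Finset.compl_eq_empty_iff] using hu
        obtain ⟨e, he, hle⟩ := exists_ratio_le h h' hQ hQ1 hQ1' hε hlow hup
          (M := ρ ^ j * (x' c / x c)) hne
          (by rw [compl_compl]; exact ⟨c, hcmem j⟩) (by
            intro e he
            rw [compl_compl] at he
            simpa [A] using he)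
        have hmem : e ∈ A (j + 1) := by
          simp only [A, Finset.mem_filter, Finset.mem_univ, true_and]
          refine hle.trans_eq ?_
          rw [pow_succ]
          ring
        have hss : A j ⊂ A (j + 1) :=
          Finset.ssubset_iff_subset_ne.2 ⟨hmono j, fun heq => by
            rw [heq] at he
            exact (Finset.mem_compl.1 he) hmem⟩
        have := Finset.card_lt_card hss
        omega
  have hall : A D = Finset.univ := by
    refine (hcard D).resolve_right fun hlt => ?_
    have := Finset.card_le_univ (A D)
    rw [Fintype.card_fin] at this
    omega
  have hb : b ∈ A D := by rw [hall]; exact Finset.mem_univ b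
  simp only [A, Finset.mem_filter, Finset.mem_univ, true_and] at hb
  calc x' b * x c ≤ (ρ ^ D * (x' c / x c) * x b) * x c :=
        mul_le_mul_of_nonneg_right hb (hx c).le
    _ = ρ ^ D * (x' c * x b) := by
        have := (hx c).ne'
        field_simp

/-- With `ε` the largest relative change of a transition probability, summing the pairwise ratio
bounds and using that both distributions have mass one gives `x' ≤ P x` and `x ≤ P x'`, where `P - 1
= O(ε)`. -/
theorem IsStationary.sum_sq_sub_le {D : ℕ} {Q Q' : Fin D → Fin D → ℝ} {x x' : Fin D → ℝ}
    (h : IsStationary Q x) (h' : IsStationary Q' x') (hQ : ∀ a b, 0 < Q a b)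
    (hQ1 : ∀ a, ∑ b, Q a b = 1) (hQ1' : ∀ a, ∑ b, Q' a b = 1)
    (hclose : ∀ a b, |Q' a b / Q a b - 1| ≤ 1 / 2) :
    ∑ b, (x' b - x b) ^ 2 ≤ 4 * 9 ^ D * ∑ a, ∑ b, (Q' a b / Q a b - 1) ^ 2 := by
  have hx := h.pos hQ
  have hQ' : ∀ a b, 0 < Q' a b := fun a b => by
    have h1 := (abs_le.1 (hclose a b)).1
    have h2 : 0 < Q' a b / Q a b := by linarith
    exact (div_pos_iff_of_pos_right (hQ a b)).1 h2
  have hx' := h'.pos hQ'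
  obtain ⟨c, -, -⟩ : ∃ a ∈ (Finset.univ : Finset (Fin D)), 0 < x a :=
    Finset.exists_lt_of_sum_lt (by simp [h.1.2])
  obtain ⟨⟨a₀, b₀⟩, -, hmax⟩ := Finset.exists_max_image (Finset.univ : Finset (Fin D × Fin D))
    (fun q => |Q' q.1 q.2 / Q q.1 q.2 - 1|) ⟨(c, c), Finset.mem_univ _⟩
  set ε := |Q' a₀ b₀ / Q a₀ b₀ - 1| with hεdef
  have hε0 : 0 ≤ ε := abs_nonneg _
  have hε2 : ε ≤ 1 / 2 := hclose a₀ b₀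
  have hle : ∀ a b, |Q' a b / Q a b - 1| ≤ ε := fun a b => hmax (a, b) (Finset.mem_univ _)
  have hlow : ∀ a b, (1 - ε) * Q a b ≤ Q' a b := fun a b => by
    rw [← le_div_iff₀ (hQ a b)]
    linarith [(abs_le.1 (hle a b)).1]
  have hup : ∀ a b, Q' a b ≤ (1 + ε) * Q a b := fun a b => by
    rw [← div_le_iff₀ (hQ a b)]
    linarith [(abs_le.1 (hle a b)).2]
  have hratio := h.ratio_le h' hQ hQ1 hQ1' hε0 (by linarith) hlow hup
  set P := ((1 + ε) / (1 - ε)) ^ D with hP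
  have hP0 : 0 < P := by
    have : 0 < 1 - ε := by linarith
    positivity
  have hu : ∀ b, x' b ≤ P * x b := by
    intro b
    have := Finset.sum_le_sum fun e (_ : e ∈ Finset.univ) => hratio b e
    rw [← Finset.mul_sum, h.1.2, mul_one, ← Finset.mul_sum, ← Finset.sum_mul, h'.1.2, one_mul] at this
    exact this
  have hl : ∀ b, x b ≤ P * x' b := by
    intro b
    have := Finset.sum_le_sum fun e (_ : e ∈ Finset.univ) => hratio e b
    rw [← Finset.sum_mul, h'.1.2, one_mul, ← Finset.mul_sum, ← Finset.mul_sum, h.1.2, mul_one] at this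
    exact this
  -- Since `ε ≤ 1/2`, the ratio is at most `1 + 4ε = (1 - 2ε) · 1 + 2ε · 3`; convexity of the `D`-th
  -- power makes the bound linear in `ε`.
  have hPK : P - 1 ≤ 2 * ε * 3 ^ D := by
    have hρ : (1 + ε) / (1 - ε) ≤ 1 + 4 * ε := by
      rw [div_le_iff₀ (by linarith)]
      nlinarith
    obtain ⟨-, hpow⟩ := convexOn_pow (𝕜 := ℝ) D
    have hconv := hpow (Set.mem_Ici.2 zero_le_one)
      (Set.mem_Ici.2 (zero_le_three (α := ℝ)))
      (a := 1 - 2 * ε) (b := 2 * ε) (by linarith) (by linarith) (by ring)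
    simp only [smul_eq_mul, one_pow, mul_one] at hconv
    have h3 : P ≤ (1 + 4 * ε) ^ D := by
      have : 0 < 1 - ε := by linarith
      rw [hP]
      gcongr
    have h4 : 1 - 2 * ε + 2 * ε * 3 = 1 + 4 * ε := by ring
    rw [h4] at hconv
    linarith
  have habs : ∀ b, (x' b - x b) ^ 2 ≤ (2 * ε * 3 ^ D) ^ 2 * x b := by
    intro b
    have h1 := hu b
    have h2 := hl b
    have h3 := hx b
    have h4 := hx' b
    have hK : 0 ≤ 2 * ε * 3 ^ D := by positivity
    have hx1 : x b ≤ 1 := by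
      rw [← h.1.2]
      exact Finset.single_le_sum (f := x) (fun b _ => (hx b).le) (Finset.mem_univ b)
    have h5 : |x' b - x b| ≤ (2 * ε * 3 ^ D) * x b := by
      have h6 := mul_le_mul_of_nonneg_right hPK h3.le
      rw [abs_le]
      constructor
      · rcases le_total (x b) (x' b) with hle | hle
        · have := mul_nonneg hK h3.le
          linarith
        · have h7 := mul_le_mul_of_nonneg_right hPK h4.le
          have h8 := mul_le_mul_of_nonneg_left hle hK
          linarith
      · linarith
    calc (x' b - x b) ^ 2 = |x' b - x b| ^ 2 := (sq_abs _).symm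
      _ ≤ ((2 * ε * 3 ^ D) * x b) ^ 2 := by gcongr
      _ = (2 * ε * 3 ^ D) ^ 2 * x b * x b := by ring
      _ ≤ (2 * ε * 3 ^ D) ^ 2 * x b * 1 := by gcongr
      _ = _ := mul_one _
  have hεle : ε ^ 2 ≤ ∑ a, ∑ b, (Q' a b / Q a b - 1) ^ 2 := by
    rw [hεdef, sq_abs]
    exact (Finset.single_le_sum (f := fun b => (Q' a₀ b / Q a₀ b - 1) ^ 2)
      (fun b _ => sq_nonneg _) (Finset.mem_univ b₀)).trans
      (Finset.single_le_sum (f := fun a => ∑ b, (Q' a b / Q a b - 1) ^ 2)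
        (fun a _ => Finset.sum_nonneg fun b _ => sq_nonneg _) (Finset.mem_univ a₀))
  calc ∑ b, (x' b - x b) ^ 2 ≤ ∑ b, (2 * ε * 3 ^ D) ^ 2 * x b :=
        Finset.sum_le_sum fun b _ => habs b
    _ = 4 * 9 ^ D * ε ^ 2 := by
        rw [← Finset.mul_sum, h.1.2, show (9 : ℝ) = 3 ^ 2 by norm_num, ← pow_mul, mul_comm 2 D]
        ring
    _ ≤ _ := by gcongr

/-! ### Averages of shifted points as initializations -/

theorem stdSimplex_le_one {D : ℕ} {x : Fin D → ℝ} (hx : x ∈ stdSimplex ℝ (Fin D)) (b : Fin D) :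
    x b ≤ 1 := by
  rw [← hx.2]
  exact Finset.single_le_sum (f := x) (fun b _ => hx.1 b) (Finset.mem_univ b)

theorem sum_sq_le_one {D : ℕ} {x : Fin D → ℝ} (hx : x ∈ stdSimplex ℝ (Fin D)) :
    ∑ b, x b ^ 2 ≤ 1 := by
  rw [← hx.2]
  refine Finset.sum_le_sum fun b _ => ?_
  have h0 := hx.1 b
  have h1 := stdSimplex_le_one hx b
  nlinarith

theorem sum_sq_sub_le_two {D : ℕ} {x y : Fin D → ℝ} (hx : x ∈ stdSimplex ℝ (Fin D))
    (hy : y ∈ stdSimplex ℝ (Fin D)) : ∑ b, (x b - y b) ^ 2 ≤ 2 := by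
  have h : ∑ b, (x b - y b) ^ 2 ≤ ∑ b, (x b ^ 2 + y b ^ 2) := by
    refine Finset.sum_le_sum fun b _ => ?_
    nlinarith [mul_nonneg (hx.1 b) (hy.1 b)]
  rw [Finset.sum_add_distrib] at h
  linarith [sum_sq_le_one hx, sum_sq_le_one hy]

theorem openSimplex_subset {D : ℕ} : openSimplex D ⊆ stdSimplex ℝ (Fin D) :=
  fun _ hx => ⟨fun b => (hx.1 b).le, hx.2⟩

theorem le_shift {D : ℕ} {α : ℝ} (hα1 : α ≤ 1) {x : Fin D → ℝ}
    (hx : x ∈ stdSimplex ℝ (Fin D)) (b : Fin D) : α / D ≤ shift α x b := by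
  have := mul_nonneg (sub_nonneg.2 hα1) (hx.1 b)
  rw [shift, mul_one_div]
  linarith

theorem shift_mem {D : ℕ} (hD : 1 ≤ D) {α : ℝ} (hα0 : 0 < α) (hα1 : α ≤ 1) {x : Fin D → ℝ}
    (hx : x ∈ stdSimplex ℝ (Fin D)) : shift α x ∈ openSimplex D := by
  have hD' : (0 : ℝ) < D := by exact_mod_cast hD
  refine ⟨fun b => (div_pos hα0 hD').trans_le (le_shift hα1 hx b), ?_⟩
  simp only [shift]
  rw [Finset.sum_add_distrib, ← Finset.mul_sum, hx.2]
  simp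
  field_simp
  ring

theorem average_mem {D N : ℕ} (hN : 1 ≤ N) {z : ℕ → Fin D → ℝ}
    (hz : ∀ s ∈ Finset.Icc 1 N, z s ∈ openSimplex D) : average N z ∈ openSimplex D := by
  have hN' : (0 : ℝ) < N := by exact_mod_cast hN
  refine ⟨fun b => ?_, ?_⟩
  · refine mul_pos (by positivity) (Finset.sum_pos (fun s hs => (hz s hs).1 b) ?_)
    exact Finset.nonempty_Icc.2 hN
  · simp only [average]
    rw [← Finset.mul_sum, Finset.sum_comm, Finset.sum_congr rfl fun s hs => (hz s hs).2]
    simp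
    field_simp

theorem le_average {D N : ℕ} (hN : 1 ≤ N) {z : ℕ → Fin D → ℝ} {c : ℝ} {b : Fin D}
    (hz : ∀ s ∈ Finset.Icc 1 N, c ≤ z s b) : c ≤ average N z b := by
  have hN' : (0 : ℝ) < N := by exact_mod_cast hN
  rw [average, one_div, ← div_eq_inv_mul, le_div_iff₀ hN']
  have := Finset.sum_le_sum hz
  simp at this
  linarith

theorem average_succ {D N : ℕ} (hN : 1 ≤ N) (z : ℕ → Fin D → ℝ) (b : Fin D) :
    average (N + 1) z b = (N * average N z b + z (N + 1) b) / (N + 1) := by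
  have hN' : (0 : ℝ) < N := by exact_mod_cast hN
  rw [average, average, Finset.sum_Icc_succ_top (by omega)]
  push_cast
  field_simp

/-- The average minimizes the total divergence from a family of points. -/
theorem sum_bregman_average_le {D N : ℕ} {z : ℕ → Fin D → ℝ} {y : Fin D → ℝ}
    (hz : ∀ s ∈ Finset.Icc 1 N, ∀ b, 0 < z s b) (hy : ∀ b, 0 < y b) :
    ∑ s ∈ Finset.Icc 1 N, bregman (z s) (average N z) ≤
      ∑ s ∈ Finset.Icc 1 N, bregman (z s) y := by
  rcases Nat.eq_zero_or_pos N with rfl | hN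
  · simp
  have hN' : (0 : ℝ) < N := by exact_mod_cast hN
  have hp : ∀ b, 0 < average N z b := fun b =>
    mul_pos (by positivity) (Finset.sum_pos (fun s hs => hz s hs b) (Finset.nonempty_Icc.2 hN))
  rw [Finset.sum_congr rfl fun s hs => bregman_eq (hz s hs) hp,
    Finset.sum_congr rfl fun s hs => bregman_eq (hz s hs) hy, Finset.sum_comm,
    Finset.sum_comm (s := Finset.Icc 1 N)]
  refine Finset.sum_le_sum fun b _ => ?_
  -- In each coordinate the total depends on the reference point `w` only through `N (mean / w + log
  -- w)`, which is smallest at `w = mean`.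
  have key : ∀ w : ℝ, 0 < w → ∑ s ∈ Finset.Icc 1 N, (z s b / w - 1 - Real.log (z s b / w)) =
      N * (average N z b / w - 1 + Real.log w) - ∑ s ∈ Finset.Icc 1 N, Real.log (z s b) := by
    intro w hw
    have e : ∀ s ∈ Finset.Icc 1 N, z s b / w - 1 - Real.log (z s b / w) =
        z s b / w + (Real.log w - 1) - Real.log (z s b) := by
      intro s hs
      rw [Real.log_div (hz s hs b).ne' hw.ne']
      ring
    rw [Finset.sum_congr rfl e, Finset.sum_sub_distrib, Finset.sum_add_distrib, ← Finset.sum_div,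
      average]
    simp only [Finset.sum_const, Nat.card_Icc, Nat.add_sub_cancel, nsmul_eq_mul]
    field_simp
    ring
  rw [key _ (hp b), key _ (hy b), div_self (hp b).ne']
  have := sub_one_sub_log_nonneg (div_pos (hp b) (hy b))
  rw [Real.log_div (hp b).ne' (hy b).ne'] at this
  have := mul_nonneg hN'.le this
  linarith

/-- Here `q` is the average `p` of `N` points updated by `x`, so `q - p = (x - p)/(N + 1)`. Bounding
`log (p/q)` by `p/q - 1` leaves `(x - p)²/((N + 1) p q)` per coordinate, with `p q ≥ c²/2`. -/
theorem bregman_sub_bregman_le {D : ℕ} {N : ℕ} (hN : 1 ≤ N) {x p q : Fin D → ℝ} {c : ℝ}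
    (hc : 0 < c) (hx : x ∈ openSimplex D) (hp : p ∈ openSimplex D) (hcp : ∀ b, c ≤ p b)
    (hq : ∀ b, q b = (N * p b + x b) / (N + 1)) :
    bregman x p - bregman x q ≤ 4 / (c ^ 2 * (N + 1)) := by
  have hN' : (1 : ℝ) ≤ N := by exact_mod_cast hN
  have hqp : ∀ b, p b / 2 ≤ q b := by
    intro b
    rw [hq, le_div_iff₀ (by positivity)]
    nlinarith [hx.1 b, hp.1 b]
  have hq0 : ∀ b, 0 < q b := fun b => (half_pos (hp.1 b)).trans_le (hqp b)
  rw [bregman_eq hx.1 hp.1, bregman_eq hx.1 hq0, ← Finset.sum_sub_distrib]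
  have hcoord : ∀ b, (x b / p b - 1 - Real.log (x b / p b)) -
      (x b / q b - 1 - Real.log (x b / q b)) ≤ 2 / (c ^ 2 * (N + 1)) * (x b - p b) ^ 2 := by
    intro b
    have h1 := hx.1 b
    have h2 := hp.1 b
    have h3 := hq0 b
    have hlog := Real.log_le_sub_one_of_pos (div_pos h2 h3)
    rw [Real.log_div h2.ne' h3.ne'] at hlog
    rw [Real.log_div h1.ne' h2.ne', Real.log_div h1.ne' h3.ne']
    have hdiff : q b - p b = (x b - p b) / (N + 1) := by
      rw [hq]
      field_simp
      ring
    have hle : x b / p b - x b / q b + (p b / q b - 1) = (x b - p b) ^ 2 / ((N + 1) * (p b * q b)) := by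
      have : x b / p b - x b / q b + (p b / q b - 1) = (q b - p b) * (x b - p b) / (p b * q b) := by
        field_simp
        ring
      rw [this, hdiff]
      field_simp
    have hpq : c ^ 2 / 2 ≤ p b * q b := by
      have h4 := hcp b
      have h5 := hqp b
      nlinarith
    calc _ ≤ x b / p b - x b / q b + (p b / q b - 1) := by linarith
      _ = (x b - p b) ^ 2 / ((N + 1) * (p b * q b)) := hle
      _ ≤ (x b - p b) ^ 2 / ((N + 1) * (c ^ 2 / 2)) := by gcongr
      _ = _ := by field_simp
  calc _ ≤ ∑ b, 2 / (c ^ 2 * (N + 1)) * (x b - p b) ^ 2 := Finset.sum_le_sum fun b _ => hcoord b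
    _ = 2 / (c ^ 2 * (N + 1)) * ∑ b, (x b - p b) ^ 2 := by rw [Finset.mul_sum]
    _ ≤ 2 / (c ^ 2 * (N + 1)) * 2 := by
        gcongr
        exact sum_sq_sub_le_two (openSimplex_subset hx) (openSimplex_subset hp)
    _ = _ := by ring

theorem uniform_mem {D : ℕ} (hD : 1 ≤ D) : (fun _ => 1 / (D : ℝ)) ∈ openSimplex D := by
  have hD' : (0 : ℝ) < D := by exact_mod_cast hD
  refine ⟨fun b => by positivity, ?_⟩
  simp
  field_simp

theorem bregman_uniform_le {D : ℕ} (hD : 1 ≤ D) {α : ℝ} (hα0 : 0 < α) {x : Fin D → ℝ}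
    (hx : x ∈ openSimplex D) (hαx : ∀ b, α / D ≤ x b) :
    bregman x (fun _ => 1 / (D : ℝ)) ≤ D / α := by
  have hD' : (0 : ℝ) < D := by exact_mod_cast hD
  rw [bregman_eq hx.1 (uniform_mem hD).1]
  have hcoord : ∀ b, x b / (1 / (D : ℝ)) - 1 - Real.log (x b / (1 / (D : ℝ))) ≤
      D * x b + (1 / α - 2) := by
    intro b
    have hpos : 0 < x b / (1 / (D : ℝ)) := div_pos (hx.1 b) (by positivity)
    have h1 := Real.one_sub_inv_le_log_of_pos hpos
    have h2 : (x b / (1 / (D : ℝ)))⁻¹ ≤ 1 / α := by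
      rw [← one_div]
      refine one_div_le_one_div_of_le hα0 ?_
      have := hαx b
      rw [div_le_iff₀ hD'] at this
      simpa using this
    have h3 : x b / (1 / (D : ℝ)) = D * x b := by field_simp
    linarith
  refine (Finset.sum_le_sum fun b _ => hcoord b).trans ?_
  rw [Finset.sum_add_distrib, ← Finset.mul_sum, hx.2]
  simp only [Finset.sum_const, Finset.card_univ, Fintype.card_fin, nsmul_eq_mul]
  have : (D : ℝ) / α = D * (1 / α) := by ring
  rw [this]
  nlinarith

/-- Following the average of the previous points competes with the average of all points. -/
theorem sum_bregman_followAverage_le {D T : ℕ} (hD : 1 ≤ D) {α : ℝ} (hα0 : 0 < α) (hα1 : α ≤ 1)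
    {z : ℕ → Fin D → ℝ} (hz : ∀ s ∈ Finset.Icc 1 T, z s ∈ openSimplex D)
    (hαz : ∀ s ∈ Finset.Icc 1 T, ∀ b, α / D ≤ z s b) :
    ∑ t ∈ Finset.Icc 1 T,
        bregman (z t) (if t ≤ 1 then fun _ => 1 / (D : ℝ) else average (t - 1) z) ≤
      ∑ t ∈ Finset.Icc 1 T, bregman (z t) (average T z) +
        4 * D ^ 2 / α ^ 2 * (1 + Real.log T) := by
  have hD' : (1 : ℝ) ≤ D := by exact_mod_cast hD
  have hind : ∀ N ≤ T, ∑ t ∈ Finset.Icc 1 N,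
        bregman (z t) (if t ≤ 1 then fun _ => 1 / (D : ℝ) else average (t - 1) z) ≤
      ∑ t ∈ Finset.Icc 1 N, bregman (z t) (average N z) +
        4 * D ^ 2 / α ^ 2 * ∑ t ∈ Finset.Icc 1 N, ((t : ℕ) : ℝ)⁻¹ := by
    intro N
    induction N with
    | zero => intro _; simp
    | succ N ih =>
      intro hN
      have hmem : N + 1 ∈ Finset.Icc 1 T := Finset.mem_Icc.2 ⟨by omega, hN⟩
      have hsub : ∀ s ∈ Finset.Icc 1 N, s ∈ Finset.Icc 1 T := fun s hs => by
        rw [Finset.mem_Icc] at hs ⊢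
        omega
      have hsub' : ∀ s ∈ Finset.Icc 1 (N + 1), s ∈ Finset.Icc 1 T := fun s hs => by
        rw [Finset.mem_Icc] at hs ⊢
        omega
      have havg : average (N + 1) z ∈ openSimplex D :=
        average_mem (by omega) fun s hs => hz s (hsub' s hs)
      have h1 := ih (by omega)
      -- The average of the first `N` points is optimal for them, so passing to the average of `N +
      -- 1` points can only raise their total; only the newest term has to be compared.
      have h2 := sum_bregman_average_le (N := N) (z := z) (fun s hs => (hz s (hsub s hs)).1) havg.1
      rw [Finset.sum_Icc_succ_top (by omega), Finset.sum_Icc_succ_top (by omega),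
        Finset.sum_Icc_succ_top (by omega), mul_add]
      suffices h3 : bregman (z (N + 1))
          (if N + 1 ≤ 1 then fun _ => 1 / (D : ℝ) else average (N + 1 - 1) z) ≤
          bregman (z (N + 1)) (average (N + 1) z) +
          4 * D ^ 2 / α ^ 2 * ((N + 1 : ℕ) : ℝ)⁻¹ by linarith
      rcases Nat.eq_zero_or_pos N with rfl | hpos
      · have h3 := bregman_uniform_le hD hα0 (hz 1 hmem) (hαz 1 hmem)
        have h4 := bregman_nonneg (hz 1 hmem).1 havg.1
        -- The uniform start in the first task fits the same error term because `α ≤ 1 ≤ D`.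
        have h5 : D / α ≤ 4 * D ^ 2 / α ^ 2 := by
          rw [div_le_div_iff₀ hα0 (by positivity)]
          have : α ^ 2 ≤ α := by nlinarith
          calc D * α ^ 2 ≤ D * α := by gcongr
            _ ≤ D * (D * α) := by gcongr; nlinarith
            _ ≤ 4 * D ^ 2 * α := by nlinarith [mul_pos (show (0 : ℝ) < D ^ 2 by positivity) hα0]
        simp at h3 h4 h5 ⊢
        linarith
      · rw [if_neg (by omega), Nat.add_sub_cancel]
        have hpmem := average_mem hpos fun s hs => hz s (hsub s hs)
        have h3 := bregman_sub_bregman_le hpos (c := α / D) (by positivity) (hz _ hmem) hpmem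
          (fun b => le_average hpos fun s hs => hαz s (hsub s hs) b) (average_succ hpos z)
        have h4 : 4 / ((α / D) ^ 2 * ((N : ℝ) + 1)) = 4 * D ^ 2 / α ^ 2 * ((N + 1 : ℕ) : ℝ)⁻¹ := by
          push_cast
          field_simp
        linarith
  refine (hind T le_rfl).trans ?_
  gcongr
  have h := harmonic_le_one_add_log T
  rw [harmonic_eq_sum_Icc] at h
  push_cast at h
  exact h

/-! ### One player in one repeated game -/

/-- One player running the Blum--Mansour reduction with log-barrier OMD: strategies `p`, utilities
`u` bounded by `C`, base strategies `Q`, secondary iterates `y` and initializations `x₀`. -/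
structure IsBMRun {D : ℕ} (m : ℕ) (η C : ℝ) (x₀ : Fin D → Fin D → ℝ)
    (Q y : ℕ → Fin D → Fin D → ℝ) (p u : ℕ → Fin D → ℝ) : Prop where
  omd : ∀ a, IsOMD m η (x₀ a) (fun i => p (i - 1) a • u (i - 1)) (fun i => p i a • u i)
    (fun i => Q i a) (fun i => y i a)
  stationary : ∀ i ≤ m, IsStationary (Q i) (p i)
  bound : ∀ i ≤ m, ∀ b, |u i b| ≤ C
  init : ∀ a, x₀ a ∈ openSimplex D

theorem abs_div_sub_one_le_of_abs_div_sub_one_le {x y : ℝ} (hx : 0 < x) (hy : 0 < y)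
    (h : |y / x - 1| ≤ 1 / 16) : |x / y - 1| ≤ 1 / 15 := by
  obtain ⟨h1, h2⟩ := abs_le.1 h
  have e1 : 15 / 16 * x ≤ y := by
    rw [← le_div_iff₀ hx]
    linarith
  have e2 : y ≤ 17 / 16 * x := by
    rw [← div_le_iff₀ hx]
    linarith
  rw [abs_le]
  constructor
  · have : 14 / 15 ≤ x / y := by
      rw [le_div_iff₀ hy]
      linarith
    linarith
  · have : x / y ≤ 16 / 15 := by
      rw [div_le_iff₀ hy]
      linarith
    linarith

theorem abs_mul_sub_one_le {s r : ℝ} (hs : |s - 1| ≤ 1 / 15) (hr : |r - 1| ≤ 1 / 7) :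
    |s * r - 1| ≤ 1 / 2 := by
  obtain ⟨h1, h2⟩ := abs_le.1 hs
  obtain ⟨h3, h4⟩ := abs_le.1 hr
  rw [abs_le]
  constructor <;> nlinarith

theorem sq_mul_sub_one_le {s r : ℝ} (hr : |r - 1| ≤ 1 / 7) :
    (s * r - 1) ^ 2 ≤ 4 * (s - 1) ^ 2 + 4 * (r - 1) ^ 2 := by
  obtain ⟨h3, h4⟩ := abs_le.1 hr
  have hr2 : r ^ 2 ≤ 2 := by nlinarith
  have e : s * r - 1 = (s - 1) * r + (r - 1) := by ring
  have h5 : (s * r - 1) ^ 2 ≤ 2 * ((s - 1) ^ 2 * r ^ 2) + 2 * (r - 1) ^ 2 := by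
    rw [e]
    nlinarith [sq_nonneg ((s - 1) * r - (r - 1))]
  have h6 := mul_le_mul_of_nonneg_left hr2 (sq_nonneg (s - 1))
  nlinarith [sq_nonneg (r - 1)]

theorem sum_Icc_pred_le {m : ℕ} {g : ℕ → ℝ} (h0 : g 0 = 0) (hg : ∀ i ≤ m, 0 ≤ g i) :
    ∑ i ∈ Finset.Icc 1 m, g (i - 1) ≤ ∑ i ∈ Finset.Icc 1 m, g i := by
  rcases Nat.eq_zero_or_pos m with rfl | hm
  · simp
  have hind : ∀ N, ∑ i ∈ Finset.Icc 1 N, g (i - 1) + g N = ∑ i ∈ Finset.Icc 1 N, g i := by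
    intro N
    induction N with
    | zero => simp [h0]
    | succ N ih =>
      rw [Finset.sum_Icc_succ_top (by omega), Finset.sum_Icc_succ_top (by omega), ← ih,
        Nat.add_sub_cancel]
  rw [← hind m]
  linarith [hg m le_rfl]

namespace IsBMRun

variable {D m : ℕ} {η C : ℝ} {x₀ : Fin D → Fin D → ℝ} {Q y : ℕ → Fin D → Fin D → ℝ}
  {p u : ℕ → Fin D → ℝ}

theorem base_mem (h : IsBMRun m η C x₀ Q y p u) {i : ℕ} (hi : i ≤ m) (a : Fin D) :
    Q i a ∈ openSimplex D :=
  (h.omd a).base_mem (h.init a) hi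

theorem sec_mem (h : IsBMRun m η C x₀ Q y p u) {i : ℕ} (hi : i ≤ m) (a : Fin D) :
    y i a ∈ openSimplex D :=
  (h.omd a).sec_mem (h.init a) hi

theorem abs_smul_le (h : IsBMRun m η C x₀ Q y p u) {i : ℕ} (hi : i ≤ m) (a b : Fin D) :
    |(p i a • u i) b| ≤ C := by
  have hp := (h.stationary i hi).1
  rw [Pi.smul_apply, smul_eq_mul, abs_mul, abs_of_nonneg (hp.1 a)]
  exact (mul_le_of_le_one_left (abs_nonneg _) (stdSimplex_le_one hp a)).trans (h.bound i hi b)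

theorem abs_sec_div_base (h : IsBMRun m η C x₀ Q y p u) (hη : 0 < η) (hηC : 32 * η * C ≤ 1)
    {i : ℕ} (h1 : 1 ≤ i) (hi : i ≤ m) (a b : Fin D) : |y (i - 1) a b / Q i a b - 1| ≤ 1 / 16 := by
  have := ((h.omd a).step_x i (Finset.mem_Icc.2 ⟨h1, hi⟩)).abs_div_sub_one_le hη
    (h.sec_mem (by omega) a) (fun b => h.abs_smul_le (by omega : i - 1 ≤ m) a b) b
  exact this.trans (by linarith)

theorem abs_sec_div_sec (h : IsBMRun m η C x₀ Q y p u) (hη : 0 < η) (hηC : 32 * η * C ≤ 1)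
    {i : ℕ} (h1 : 1 ≤ i) (hi : i ≤ m) (a b : Fin D) : |y (i - 1) a b / y i a b - 1| ≤ 1 / 16 := by
  have := ((h.omd a).step_y i (Finset.mem_Icc.2 ⟨h1, hi⟩)).abs_div_sub_one_le hη
    (h.sec_mem (by omega) a) (fun b => h.abs_smul_le hi a b) b
  exact this.trans (by linarith)

theorem abs_base_div_sec (h : IsBMRun m η C x₀ Q y p u) (hη : 0 < η) (hηC : 32 * η * C ≤ 1)
    {i : ℕ} (h1 : 1 ≤ i) (hi : i ≤ m) (a b : Fin D) : |Q i a b / y (i - 1) a b - 1| ≤ 1 / 15 :=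
  abs_div_sub_one_le_of_abs_div_sub_one_le ((h.base_mem hi a).1 b)
    ((h.sec_mem (by omega) a).1 b) (h.abs_sec_div_base hη hηC h1 hi a b)

/-- Both iterates are steps from `y (i - 1)`, and the ratio factors through it: `(16/15)(17/16)` and
`(14/15)(15/16)` lie within `1/7` of one. In round `0` they coincide. -/
theorem abs_sec_div_base_same (h : IsBMRun m η C x₀ Q y p u) (hη : 0 < η) (hηC : 32 * η * C ≤ 1)
    {i : ℕ} (hi : i ≤ m) (a b : Fin D) : |y i a b / Q i a b - 1| ≤ 1 / 7 := by
  have hQ := (h.base_mem hi a).1 b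
  have hy := (h.sec_mem hi a).1 b
  rcases Nat.eq_zero_or_pos i with rfl | hpos
  · have e : y 0 a = Q 0 a := (h.omd a).init_y.trans (h.omd a).init_x.symm
    rw [e, div_self hQ.ne']
    norm_num
  · have hw := (h.sec_mem (by omega : i - 1 ≤ m) a).1 b
    obtain ⟨h1, h2⟩ := abs_le.1 (h.abs_sec_div_base hη hηC hpos hi a b)
    obtain ⟨h3, h4⟩ := abs_le.1 (abs_div_sub_one_le_of_abs_div_sub_one_le hy hw
      (h.abs_sec_div_sec hη hηC hpos hi a b))
    have e : y i a b / Q i a b = (y i a b / y (i - 1) a b) * (y (i - 1) a b / Q i a b) := by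
      field_simp
    rw [e, abs_le]
    constructor <;> nlinarith

/-- The second-order path length of the play is bounded by the divergences of the base runs. -/
theorem path_le (h : IsBMRun m η C x₀ Q y p u) (hη : 0 < η) (hηC : 32 * η * C ≤ 1) :
    ∑ i ∈ Finset.Icc 1 m, ∑ b, (p i b - p (i - 1) b) ^ 2 ≤ 96 * 9 ^ D *
      ∑ i ∈ Finset.Icc 1 m, ∑ a, (bregman (y i a) (Q i a) + bregman (Q i a) (y (i - 1) a)) := by
  have hstep : ∀ i ∈ Finset.Icc 1 m, ∑ b, (p i b - p (i - 1) b) ^ 2 ≤ 96 * 9 ^ D *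
      (∑ a, bregman (y (i - 1) a) (Q (i - 1) a) + ∑ a, bregman (Q i a) (y (i - 1) a)) := by
    intro i hi
    obtain ⟨h1, hm⟩ := Finset.mem_Icc.1 hi
    have hm' : i - 1 ≤ m := by omega
    -- Consecutive base strategies are compared through the secondary iterate between them. The
    -- constants are `24 = 4 · 6` and `96 = 4 · 24`.
    have hmul : ∀ a b, Q i a b / Q (i - 1) a b =
        (Q i a b / y (i - 1) a b) * (y (i - 1) a b / Q (i - 1) a b) := by
      intro a b
      have := ((h.sec_mem hm' a).1 b).ne'
      field_simp
    have hst := (h.stationary (i - 1) hm').sum_sq_sub_le (h.stationary i hm)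
      (fun a b => (h.base_mem hm' a).1 b) (fun a => (h.base_mem hm' a).2)
      (fun a => (h.base_mem hm a).2) (fun a b => by
        rw [hmul]
        exact abs_mul_sub_one_le (h.abs_base_div_sec hη hηC h1 hm a b)
          (h.abs_sec_div_base_same hη hηC hm' a b))
    have hsum : ∑ a, ∑ b, (Q i a b / Q (i - 1) a b - 1) ^ 2 ≤
        24 * (∑ a, bregman (y (i - 1) a) (Q (i - 1) a) + ∑ a, bregman (Q i a) (y (i - 1) a)) := by
      rw [← Finset.sum_add_distrib, Finset.mul_sum]
      refine Finset.sum_le_sum fun a _ => ?_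
      have hle : ∑ b, (Q i a b / Q (i - 1) a b - 1) ^ 2 ≤
          ∑ b, (4 * (Q i a b / y (i - 1) a b - 1) ^ 2 +
            4 * (y (i - 1) a b / Q (i - 1) a b - 1) ^ 2) := by
        refine Finset.sum_le_sum fun b _ => ?_
        rw [hmul]
        exact sq_mul_sub_one_le (h.abs_sec_div_base_same hη hηC hm' a b)
      rw [Finset.sum_add_distrib, ← Finset.mul_sum, ← Finset.mul_sum] at hle
      have e1 := sum_sq_div_sub_one_le (h.base_mem hm a).1 (h.sec_mem hm' a).1 (fun b => by
        linarith [(abs_le.1 (h.abs_base_div_sec hη hηC h1 hm a b)).2])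
      have e2 := sum_sq_div_sub_one_le (h.sec_mem hm' a).1 (h.base_mem hm' a).1 (fun b => by
        linarith [(abs_le.1 (h.abs_sec_div_base_same hη hηC hm' a b)).2])
      linarith
    calc _ ≤ _ := hst
      _ ≤ 4 * 9 ^ D * (24 * (∑ a, bregman (y (i - 1) a) (Q (i - 1) a) +
          ∑ a, bregman (Q i a) (y (i - 1) a))) := by gcongr
      _ = _ := by ring
  refine (Finset.sum_le_sum hstep).trans ?_
  rw [← Finset.mul_sum]
  refine mul_le_mul_of_nonneg_left ?_ (by positivity)
  simp only [Finset.sum_add_distrib]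
  refine add_le_add ?_ le_rfl
  -- Shifting the index costs nothing: the divergence of round `0` is zero because both iterates
  -- start at the same point.
  refine sum_Icc_pred_le (g := fun i => ∑ a, bregman (y i a) (Q i a)) ?_ ?_
  · refine Finset.sum_eq_zero fun a _ => ?_
    have e : y 0 a = Q 0 a := (h.omd a).init_y.trans (h.omd a).init_x.symm
    rw [e, bregman_self]
  · intro i hi
    exact Finset.sum_nonneg fun a _ => bregman_nonneg (h.sec_mem hi a).1 (h.base_mem hi a).1

/-- The inner products of the prediction errors with the corrections of the iterates. -/
theorem error_le (h : IsBMRun m η C x₀ Q y p u) (hη : 0 < η) (hηC : 32 * η * C ≤ 1)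
    {i : ℕ} (hi : i ≤ m) :
    ∑ a, (y i a - Q i a) ⬝ᵥ (p i a • u i - p (i - 1) a • u (i - 1)) ≤
      6 * η * (∑ b, (u i b - u (i - 1) b) ^ 2 + C ^ 2 * ∑ b, (p i b - p (i - 1) b) ^ 2) +
        1 / (2 * η) * ∑ a, bregman (y i a) (Q i a) := by
  have hm' : i - 1 ≤ m := by omega
  have hp := (h.stationary i hi).1
  have hone : ∀ a, (y i a - Q i a) ⬝ᵥ (p i a • u i - p (i - 1) a • u (i - 1)) ≤
      6 * η * (p i a ^ 2 * ∑ b, (u i b - u (i - 1) b) ^ 2 + C ^ 2 * (p i a - p (i - 1) a) ^ 2) +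
        1 / (2 * η) * bregman (y i a) (Q i a) := by
    intro a
    have hQ := h.base_mem hi a
    have hb : ∀ b, (y i a - Q i a) b * (p i a • u i - p (i - 1) a • u (i - 1)) b ≤
        6 * η * (p i a ^ 2 * (u i b - u (i - 1) b) ^ 2 +
          C ^ 2 * (p i a - p (i - 1) a) ^ 2 * Q i a b ^ 2) +
        1 / (12 * η) * (y i a b / Q i a b - 1) ^ 2 := by
      intro b
      have hq0 := hQ.1 b
      have hq1 : Q i a b ^ 2 ≤ 1 :=
        pow_le_one₀ hq0.le (stdSimplex_le_one (openSimplex_subset hQ) b)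
      have hu2 : u (i - 1) b ^ 2 ≤ C ^ 2 := sq_le_sq' (abs_le.1 (h.bound _ hm' b)).1
        (abs_le.1 (h.bound _ hm' b)).2
      simp only [Pi.sub_apply, Pi.smul_apply, smul_eq_mul]
      set v := p i a * u i b - p (i - 1) a * u (i - 1) b with hv
      set s := y i a b / Q i a b - 1 with hs
      have e1 : y i a b - Q i a b = Q i a b * s := by
        rw [hs]
        field_simp
      -- Young's inequality in the local norm at `Q`. The weight `1/(12η)` turns into `1/(2η)` after
      -- the factor `6` of `sum_sq_div_sub_one_le`; keeping `Q²` avoids a dimension factor, as `∑ Q²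
      -- ≤ 1`.
      have e2 : Q i a b * s * v ≤ 3 * η * (Q i a b ^ 2 * v ^ 2) + 1 / (12 * η) * s ^ 2 := by
        have : 3 * η * (Q i a b ^ 2 * v ^ 2) + 1 / (12 * η) * s ^ 2 - Q i a b * s * v =
            1 / (12 * η) * (6 * η * (Q i a b * v) - s) ^ 2 := by
          field_simp
          ring
        have h2 : 0 ≤ 1 / (12 * η) * (6 * η * (Q i a b * v) - s) ^ 2 := by positivity
        linarith
      have e3 : v ^ 2 ≤ 2 * (p i a ^ 2 * (u i b - u (i - 1) b) ^ 2) +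
          2 * ((p i a - p (i - 1) a) ^ 2 * u (i - 1) b ^ 2) := by
        have : v = p i a * (u i b - u (i - 1) b) + (p i a - p (i - 1) a) * u (i - 1) b := by
          rw [hv]
          ring
        rw [this]
        nlinarith [sq_nonneg (p i a * (u i b - u (i - 1) b) - (p i a - p (i - 1) a) * u (i - 1) b)]
      have e4 : Q i a b ^ 2 * v ^ 2 ≤ 2 * (p i a ^ 2 * (u i b - u (i - 1) b) ^ 2 +
          C ^ 2 * (p i a - p (i - 1) a) ^ 2 * Q i a b ^ 2) := by
        calc Q i a b ^ 2 * v ^ 2 ≤ Q i a b ^ 2 * (2 * (p i a ^ 2 * (u i b - u (i - 1) b) ^ 2) +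
              2 * ((p i a - p (i - 1) a) ^ 2 * u (i - 1) b ^ 2)) := by gcongr
          _ = 2 * (Q i a b ^ 2 * (p i a ^ 2 * (u i b - u (i - 1) b) ^ 2) +
              u (i - 1) b ^ 2 * (p i a - p (i - 1) a) ^ 2 * Q i a b ^ 2) := by ring
          _ ≤ 2 * (1 * (p i a ^ 2 * (u i b - u (i - 1) b) ^ 2) +
              C ^ 2 * (p i a - p (i - 1) a) ^ 2 * Q i a b ^ 2) := by gcongr
          _ = _ := by ring
      rw [e1]
      nlinarith
    have hQ2 := sum_sq_le_one (openSimplex_subset hQ)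
    have hB := sum_sq_div_sub_one_le (h.sec_mem hi a).1 hQ.1 (fun b => by
        linarith [(abs_le.1 (h.abs_sec_div_base_same hη hηC hi a b)).2])
    calc _ ≤ ∑ b, (6 * η * (p i a ^ 2 * (u i b - u (i - 1) b) ^ 2 +
          C ^ 2 * (p i a - p (i - 1) a) ^ 2 * Q i a b ^ 2) +
          1 / (12 * η) * (y i a b / Q i a b - 1) ^ 2) := Finset.sum_le_sum fun b _ => hb b
      _ = 6 * η * (p i a ^ 2 * ∑ b, (u i b - u (i - 1) b) ^ 2 +
          C ^ 2 * (p i a - p (i - 1) a) ^ 2 * ∑ b, Q i a b ^ 2) +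
          1 / (12 * η) * ∑ b, (y i a b / Q i a b - 1) ^ 2 := by
        simp only [Finset.sum_add_distrib, Finset.mul_sum]
        simp only [mul_add, Finset.sum_add_distrib, Finset.mul_sum]
      _ ≤ 6 * η * (p i a ^ 2 * ∑ b, (u i b - u (i - 1) b) ^ 2 +
          C ^ 2 * (p i a - p (i - 1) a) ^ 2 * 1) +
          1 / (12 * η) * (6 * bregman (y i a) (Q i a)) := by gcongr
      _ = _ := by
        field_simp
        ring
  refine (Finset.sum_le_sum fun a _ => hone a).trans ?_
  rw [Finset.sum_add_distrib, ← Finset.mul_sum, ← Finset.mul_sum, Finset.sum_add_distrib,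
    ← Finset.sum_mul, ← Finset.mul_sum]
  gcongr
  exact mul_le_of_le_one_left (Finset.sum_nonneg fun b _ => sq_nonneg _) (sum_sq_le_one hp)

/-- The total regret of the base runs is bounded by the variation of utilities and play (RVU). -/
theorem regret_le (h : IsBMRun m η C x₀ Q y p u) (hη : 0 < η) (hηC : 32 * η * C ≤ 1)
    {z : Fin D → Fin D → ℝ} (hz : ∀ a, z a ∈ openSimplex D) :
    ∑ a, ∑ i ∈ Finset.Icc 1 m, (z a - Q i a) ⬝ᵥ (p i a • u i) ≤
      (1 / η) * ∑ a, bregman (z a) (x₀ a) +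
      6 * η * (∑ i ∈ Finset.Icc 1 m, ∑ b, (u i b - u (i - 1) b) ^ 2 +
        C ^ 2 * ∑ i ∈ Finset.Icc 1 m, ∑ b, (p i b - p (i - 1) b) ^ 2) -
      1 / (2 * η) * ∑ i ∈ Finset.Icc 1 m, ∑ a,
        (bregman (y i a) (Q i a) + bregman (Q i a) (y (i - 1) a)) := by
  have h1 := Finset.sum_le_sum fun a (_ : a ∈ Finset.univ) =>
    (h.omd a).regret_le hη (h.init a) (hz a)
  refine h1.trans ?_
  rw [Finset.sum_add_distrib, ← Finset.mul_sum, Finset.sum_comm (s := Finset.univ)]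
  have h2 : ∀ i ∈ Finset.Icc 1 m,
      ∑ a, ((y i a - Q i a) ⬝ᵥ (p i a • u i - p (i - 1) a • u (i - 1)) -
        (1 / η) * (bregman (y i a) (Q i a) + bregman (Q i a) (y (i - 1) a))) ≤
      6 * η * (∑ b, (u i b - u (i - 1) b) ^ 2 + C ^ 2 * ∑ b, (p i b - p (i - 1) b) ^ 2) -
        1 / (2 * η) * ∑ a, (bregman (y i a) (Q i a) + bregman (Q i a) (y (i - 1) a)) := by
    intro i hi
    obtain ⟨-, hm⟩ := Finset.mem_Icc.1 hi
    have e := h.error_le hη hηC hm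
    have hn : 0 ≤ ∑ a, bregman (Q i a) (y (i - 1) a) := Finset.sum_nonneg fun a _ =>
      bregman_nonneg (h.base_mem hm a).1 (h.sec_mem (by omega) a).1
    have hn' : 0 ≤ 1 / (2 * η) * ∑ a, bregman (Q i a) (y (i - 1) a) := by positivity
    -- One half of the negative divergences absorbs the prediction error; the other half is kept to
    -- pay for the variation of play.
    have e2 : 1 / η = 1 / (2 * η) + 1 / (2 * η) := by
      field_simp
      ring
    rw [Finset.sum_sub_distrib, ← Finset.mul_sum, Finset.sum_add_distrib, e2]
    linarith
  have h3 := Finset.sum_le_sum h2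
  rw [Finset.sum_sub_distrib, ← Finset.mul_sum, ← Finset.mul_sum, Finset.sum_add_distrib,
    ← Finset.mul_sum] at h3
  linarith

end IsBMRun

/-! ### Swap regret and approximate correlated equilibria -/

theorem swapRegret_nonneg {D m : ℕ} {x u : ℕ → Fin D → ℝ}
    (hx : ∀ i ∈ Finset.Icc 1 m, x i ∈ stdSimplex ℝ (Fin D)) : 0 ≤ swapRegret m x u :=
  le_csSup (swapValues_bddAbove m x u hx) ⟨LinearMap.id, fun _ h => h, by simp⟩

/-- Swap regret is at most the total regret of the base minimizers against optima in hindsight. -/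
theorem swapRegret_le_sum {D m : ℕ} {Q : ℕ → Fin D → Fin D → ℝ} {x u : ℕ → Fin D → ℝ}
    {z : Fin D → Fin D → ℝ} (hst : ∀ i ∈ Finset.Icc 1 m, IsStationary (Q i) (x i))
    (hz : ∀ a, IsOptInHindsight m (fun i => x i a • u i) (z a)) :
    swapRegret m x u ≤ ∑ a, ∑ i ∈ Finset.Icc 1 m, (z a - Q i a) ⬝ᵥ (x i a • u i) := by
  refine csSup_le (swapValues_nonempty m x u) ?_
  rintro r ⟨φ, hφ, rfl⟩
  -- By linearity `φ (x i)` mixes the vertices' images `φ(e_a)`, and by stationarity `x i` mixes the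
  -- `Q i a`, both with weights `x i a`.
  have h1 : ∀ i ∈ Finset.Icc 1 m, (φ (x i) - x i) ⬝ᵥ u i =
      ∑ a, (φ (Pi.single a 1)) ⬝ᵥ (x i a • u i) - ∑ a, Q i a ⬝ᵥ (x i a • u i) := by
    intro i hi
    have e1 : φ (x i) = ∑ a, x i a • φ (Pi.single a 1) := by
      conv_lhs => rw [← Finset.univ_sum_single (x i)]
      rw [map_sum]
      refine Finset.sum_congr rfl fun a _ => ?_
      rw [← map_smul, ← Pi.single_smul]
      simp
    have e2 : x i = ∑ a, x i a • Q i a := by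
      ext b
      rw [Finset.sum_apply]
      exact ((hst i hi).2 b).symm
    rw [sub_dotProduct, e1]
    conv_lhs => rw [e2]
    simp only [sum_dotProduct, smul_dotProduct, dotProduct_smul]
    congr 1
    refine Finset.sum_congr rfl fun a _ => ?_
    rw [← e2]
  rw [Finset.sum_congr rfl h1, Finset.sum_sub_distrib, Finset.sum_comm,
    Finset.sum_comm (s := Finset.Icc 1 m), ← Finset.sum_sub_distrib]
  refine Finset.sum_le_sum fun a _ => ?_
  simp only [sub_dotProduct]
  rw [Finset.sum_sub_distrib]
  refine sub_le_sub_right ((hz a).2 (hφ ?_)) _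
  exact single_mem_stdSimplex ℝ a

/-- Moving the optima in hindsight towards the uniform distribution costs at most `2 α m`. -/
theorem sum_shift_le {D m : ℕ} {α : ℝ} (hα : 0 ≤ α) (hD : 1 ≤ D) {Q : ℕ → Fin D → Fin D → ℝ}
    {x u : ℕ → Fin D → ℝ} {z : Fin D → Fin D → ℝ}
    (hx : ∀ i ∈ Finset.Icc 1 m, x i ∈ stdSimplex ℝ (Fin D))
    (hu : ∀ i ∈ Finset.Icc 1 m, ∀ b, |u i b| ≤ 1) (hz : ∀ a, z a ∈ stdSimplex ℝ (Fin D)) :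
    ∑ a, ∑ i ∈ Finset.Icc 1 m, (z a - Q i a) ⬝ᵥ (x i a • u i) ≤
      ∑ a, ∑ i ∈ Finset.Icc 1 m, (shift α (z a) - Q i a) ⬝ᵥ (x i a • u i) + 2 * α * m := by
  have hdot : ∀ i ∈ Finset.Icc 1 m, ∀ w ∈ stdSimplex ℝ (Fin D), |w ⬝ᵥ u i| ≤ 1 := by
    intro i hi w hw
    calc |w ⬝ᵥ u i| ≤ ∑ b, |w b * u i b| := Finset.abs_sum_le_sum_abs _ _
      _ ≤ ∑ b, w b := by
        refine Finset.sum_le_sum fun b _ => ?_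
        rw [abs_mul, abs_of_nonneg (hw.1 b)]
        exact mul_le_of_le_one_right (hw.1 b) (hu i hi b)
      _ = 1 := hw.2
  have hstep : ∀ a, ∀ i ∈ Finset.Icc 1 m, (z a - Q i a) ⬝ᵥ (x i a • u i) ≤
      (shift α (z a) - Q i a) ⬝ᵥ (x i a • u i) + 2 * α * x i a := by
    intro a i hi
    have e : z a - Q i a = (shift α (z a) - Q i a) +
        α • (z a - fun _ => 1 / (D : ℝ)) := by
      ext b
      simp only [shift, Pi.sub_apply, Pi.add_apply, Pi.smul_apply, smul_eq_mul]
      ring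
    have h1 := (abs_le.1 (hdot i hi _ (hz a))).2
    have h2 := (abs_le.1 (hdot i hi _ (openSimplex_subset (uniform_mem hD)))).1
    rw [e, add_dotProduct, smul_dotProduct, dotProduct_smul, dotProduct_smul,
      sub_dotProduct (z a)]
    simp only [smul_eq_mul]
    -- The factor `x i a` is retained, so that summing over `a` gives `2 α` per round rather than `2
    -- α D`.
    have h3 : α * (x i a * (z a ⬝ᵥ u i - (fun _ => 1 / (D : ℝ)) ⬝ᵥ u i)) ≤ α * (x i a * 2) := by
      have := (hx i hi).1 a
      gcongr
      linarith
    linarith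
  calc _ ≤ ∑ a, ∑ i ∈ Finset.Icc 1 m,
        ((shift α (z a) - Q i a) ⬝ᵥ (x i a • u i) + 2 * α * x i a) :=
        Finset.sum_le_sum fun a _ => Finset.sum_le_sum fun i hi => hstep a i hi
    _ = _ := by
      simp only [Finset.sum_add_distrib]
      rw [Finset.sum_comm (f := fun a i => 2 * α * x i a)]
      simp only [← Finset.mul_sum]
      rw [Finset.sum_congr rfl fun i hi => (hx i hi).2]
      simp

variable {n : ℕ} {d : Fin n → ℕ}

/-- The expected utility of a player who remaps her drawn action. -/
theorem sum_prod_mul_update (u : Game n d) (k : Fin n) (x : Profile d)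
    (φ : Fin (d k) → Fin (d k)) :
    ∑ a : (j : Fin n) → Fin (d j), (∏ j, x j (a j)) * u k (Function.update a k (φ (a k))) =
      ∑ b, x k b * utilVec u k x (φ b) := by
  have hutil : ∀ c, utilVec u k x c =
      ∑ a ∈ Finset.univ.filter (fun a : (j : Fin n) → Fin (d j) => a k = c),
        (∏ j ∈ Finset.univ.erase k, x j (a j)) * u k a := by
    intro c
    rw [utilVec, expUtil, Finset.sum_filter]
    refine Finset.sum_congr rfl fun a _ => ?_
    rw [← Finset.mul_prod_erase _ _ (Finset.mem_univ k), Function.update_self, Pi.single_apply]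
    have : ∏ j ∈ Finset.univ.erase k, Function.update x k (Pi.single c 1) j (a j) =
        ∏ j ∈ Finset.univ.erase k, x j (a j) :=
      Finset.prod_congr rfl fun j hj => by
        rw [Function.update_of_ne (Finset.ne_of_mem_erase hj)]
    rw [this]
    split_ifs <;> simp
  rw [← Finset.sum_fiberwise (s := Finset.univ) (g := fun a : (j : Fin n) → Fin (d j) => a k)]
  refine Finset.sum_congr rfl fun b _ => ?_
  rw [hutil, Finset.mul_sum]
  -- Among profiles with drawn action `b`, replacing coordinate `k` by `φ b` is a bijection onto
  -- those with action `φ b`; the other players' probabilities are unchanged.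
  refine Finset.sum_bij' (fun a _ => Function.update a k (φ b)) (fun a _ => Function.update a k b)
    ?_ ?_ ?_ ?_ ?_
  · intro a _
    simp
  · intro a _
    simp
  · intro a ha
    simp only [Finset.mem_filter, Finset.mem_univ, true_and] at ha
    rw [Function.update_idem, ← ha, Function.update_eq_self]
  · intro a ha
    simp only [Finset.mem_filter, Finset.mem_univ, true_and] at ha
    rw [Function.update_idem, ← ha, Function.update_eq_self]
  · intro a ha
    simp only [Finset.mem_filter, Finset.mem_univ, true_and] at ha
    have : ∏ j ∈ Finset.univ.erase k, x j (Function.update a k (φ b) j) =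
        ∏ j ∈ Finset.univ.erase k, x j (a j) :=
      Finset.prod_congr rfl fun j hj => by
        rw [Function.update_of_ne (Finset.ne_of_mem_erase hj)]
    rw [this, ← Finset.mul_prod_erase _ _ (Finset.mem_univ k), ha]
    ring

theorem sum_prod_mul (u : Game n d) (k : Fin n) (x : Profile d) :
    ∑ a : (j : Fin n) → Fin (d j), (∏ j, x j (a j)) * u k a = x k ⬝ᵥ utilVec u k x := by
  simpa [Function.update_eq_self, dotProduct] using sum_prod_mul_update u k x id

/-- The gain from remapping the actions is at most the swap regret. -/
theorem sum_remap_sub_le_swapRegret {D m : ℕ} {x u : ℕ → Fin D → ℝ}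
    (hx : ∀ i ∈ Finset.Icc 1 m, x i ∈ stdSimplex ℝ (Fin D)) (φ : Fin D → Fin D) :
    ∑ i ∈ Finset.Icc 1 m, (∑ b, x i b * u i (φ b) - x i ⬝ᵥ u i) ≤ swapRegret m x u := by
  refine le_csSup (swapValues_bddAbove m x u hx) ?_
  -- The linear extension of the remapping, sending `e_b` to `e_{φ b}`.
  refine ⟨∑ b, (LinearMap.proj b : (Fin D → ℝ) →ₗ[ℝ] ℝ).smulRight (Pi.single (φ b) 1), ?_, ?_⟩
  · intro w hw
    rw [LinearMap.sum_apply]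
    simp only [LinearMap.smulRight_apply, LinearMap.proj_apply]
    exact (convex_stdSimplex ℝ (Fin D)).sum_mem (fun b _ => hw.1 b) hw.2
      fun b _ => single_mem_stdSimplex ℝ (φ b)
  · refine Finset.sum_congr rfl fun i _ => ?_
    rw [LinearMap.sum_apply, sub_dotProduct, sum_dotProduct]
    simp

theorem isApproxCE_avgPlay {m : ℕ} (hm : 1 ≤ m) {u : Game n d} {x : ℕ → Profile d} {ε : ℝ}
    (hx : ∀ i ∈ Finset.Icc 1 m, ∀ k, x i k ∈ stdSimplex ℝ (Fin (d k)))
    (hε : ∀ k, 1 / (m : ℝ) * swapRegret m (fun i => x i k) (fun i => utilVec u k (x i)) ≤ ε) :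
    IsApproxCE u ε (avgPlay m x) := by
  intro k φ
  have hm' : (0 : ℝ) < m := by exact_mod_cast hm
  have havg : ∀ f : ((j : Fin n) → Fin (d j)) → ℝ, ∑ a, avgPlay m x a * f a =
      (1 / (m : ℝ)) * ∑ i ∈ Finset.Icc 1 m, ∑ a, (∏ j, x i j (a j)) * f a := by
    intro f
    rw [Finset.sum_comm, Finset.mul_sum]
    refine Finset.sum_congr rfl fun a _ => ?_
    rw [avgPlay, mul_assoc, Finset.sum_mul]
  rw [havg, havg, Finset.sum_congr rfl fun i _ => sum_prod_mul_update u k (x i) φ,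
    Finset.sum_congr rfl fun i _ => sum_prod_mul u k (x i)]
  have h1 := sum_remap_sub_le_swapRegret (x := fun i => x i k) (u := fun i => utilVec u k (x i))
    (fun i hi => hx i hi k) φ
  rw [Finset.sum_sub_distrib] at h1
  have h2 := mul_le_mul_of_nonneg_left h1 (show 0 ≤ 1 / (m : ℝ) by positivity)
  have h3 := hε k
  linarith

/-! ### Repeated games with meta-learned initializations -/

/-- In a Lipschitz game, a bound on one utility vector yields a bound on all of them. -/
theorem IsLipschitzGame.abs_utilVec_le {u : Game n d} {L : ℝ} (hu : IsLipschitzGame u L)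
    {k : Fin n} {x y : Profile d} (hx : ∀ j, x j ∈ stdSimplex ℝ (Fin (d j)))
    (hy : ∀ j, y j ∈ stdSimplex ℝ (Fin (d j))) (hyu : ∀ b, |utilVec u k y b| ≤ 1)
    (b : Fin (d k)) : |utilVec u k x b| ≤ 2 + 2 * n * L ^ 2 := by
  have h1 := hu k x y hx hy
  have h2 : (utilVec u k x b - utilVec u k y b) ^ 2 ≤ 2 * n * L ^ 2 := by
    calc (utilVec u k x b - utilVec u k y b) ^ 2 ≤
          ∑ b, (utilVec u k x b - utilVec u k y b) ^ 2 :=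
          Finset.single_le_sum (f := fun b => (utilVec u k x b - utilVec u k y b) ^ 2)
            (fun b _ => sq_nonneg _) (Finset.mem_univ b)
      _ ≤ L ^ 2 * ∑ j ∈ Finset.univ.erase k, ∑ b, (x j b - y j b) ^ 2 := h1
      _ ≤ L ^ 2 * ∑ j : Fin n, ∑ b, (x j b - y j b) ^ 2 := by
        gcongr
        exact Finset.subset_univ _
      _ ≤ L ^ 2 * ∑ j : Fin n, 2 := by
        gcongr with j
        exact sum_sq_sub_le_two (hx j) (hy j)
      _ = 2 * n * L ^ 2 := by
        simp
        ring
  have h3 := abs_le.1 (hyu b)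
  -- From `s² ≤ K` it follows that `s ≤ 1 + K`, which avoids a square root in the constant.
  have h4 : |utilVec u k x b - utilVec u k y b| ≤ 1 + 2 * n * L ^ 2 := by
    rw [← sq_abs] at h2
    nlinarith [sq_nonneg (|utilVec u k x b - utilVec u k y b| - 1),
      abs_nonneg (utilVec u k x b - utilVec u k y b)]
  have h5 := abs_le.1 h4
  rw [abs_le]
  constructor <;> linarith

theorem IsMetaRun.shiftedOpt_mem {G : ℕ → Game n d} {m T : ℕ} {η α : ℝ} {R : Trajectory n d}
    (h : IsMetaRun G m T η α R) (hd : ∀ k, 1 ≤ d k) (hα0 : 0 < α) (hα1 : α ≤ 1) {t : ℕ}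
    (ht : t ∈ Finset.Icc 1 T) (k : Fin n) (a : Fin (d k)) :
    R.shiftedOpt α k a t ∈ openSimplex (d k) :=
  shift_mem (hd k) hα0 hα1 (h.opt t ht k a).1

theorem IsMetaRun.init_mem {G : ℕ → Game n d} {m T : ℕ} {η α : ℝ} {R : Trajectory n d}
    (h : IsMetaRun G m T η α R) (hd : ∀ k, 1 ≤ d k) (hα0 : 0 < α) (hα1 : α ≤ 1) {t : ℕ}
    (ht : t ∈ Finset.Icc 1 T) (k : Fin n) (a : Fin (d k)) : R.init α t k a ∈ openSimplex (d k) := by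
  rw [Trajectory.init]
  split_ifs with h1
  · exact uniform_mem (hd k)
  · refine average_mem (by omega) fun s hs => h.shiftedOpt_mem hd hα0 hα1 ?_ k a
    rw [Finset.mem_Icc] at hs ht ⊢
    omega

/-- Utilities are assumed bounded by one only from round `1` on, but round `0` supplies the first
prediction. Comparing with round `1` through the Lipschitz condition gives the constant `2 + 2nL²`
for all rounds. -/
theorem IsMetaRun.isBMRun {G : ℕ → Game n d} {m T : ℕ} {η α L : ℝ} {R : Trajectory n d}
    (h : IsMetaRun G m T η α R) (hd : ∀ k, 1 ≤ d k) (hm : 1 ≤ m) (hα0 : 0 < α) (hα1 : α ≤ 1)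
    {t : ℕ} (ht : t ∈ Finset.Icc 1 T) (hG : IsLipschitzGame (G t) L)
    (hu : ∀ i ∈ Finset.Icc 1 m, ∀ (k : Fin n) (b : Fin (d k)),
      |utilVec (G t) k (R.play t i) b| ≤ 1) (k : Fin n) :
    IsBMRun m η (2 + 2 * n * L ^ 2) (fun a => R.init α t k a) (fun i => R.base t i k)
      (fun i => R.sec t i k) (fun i => R.play t i k) (fun i => utilVec (G t) k (R.play t i)) where
  omd := h.omd t ht k
  stationary i hi := h.stationary t ht i (Finset.mem_Icc.2 ⟨i.zero_le, hi⟩) k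
  init a := h.init_mem hd hα0 hα1 ht k a
  bound i hi b := hG.abs_utilVec_le
    (fun j => (h.stationary t ht i (Finset.mem_Icc.2 ⟨i.zero_le, hi⟩) j).1)
    (fun j => (h.stationary t ht 1 (Finset.mem_Icc.2 ⟨zero_le_one, hm⟩) j).1)
    (fun b => hu 1 (Finset.mem_Icc.2 ⟨le_rfl, hm⟩) k b) b

theorem IsMetaRun.swapReg_nonneg {G : ℕ → Game n d} {m T : ℕ} {η α : ℝ} {R : Trajectory n d}
    (h : IsMetaRun G m T η α R) {t : ℕ} (ht : t ∈ Finset.Icc 1 T) (k : Fin n) :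
    0 ≤ R.swapReg G m t k :=
  swapRegret_nonneg fun i hi => (h.stationary t ht i
    (Finset.mem_Icc.2 ⟨i.zero_le, (Finset.mem_Icc.1 hi).2⟩) k).1

/-- The learning rates up to this threshold are small enough for the variation of the play to be
compensated by the divergences between the iterates. -/
noncomputable def rateBound (d : Fin n → ℕ) (L : ℝ) : ℝ :=
  1 / (1 + 32 * (2 + 2 * n * L ^ 2) +
    1152 * (n * L ^ 2 + (2 + 2 * n * L ^ 2) ^ 2) * ∑ k, (9 : ℝ) ^ d k)

theorem rateBound_pos (d : Fin n → ℕ) (L : ℝ) : 0 < rateBound d L := by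
  unfold rateBound
  positivity

/-- Each utility varies with the play of the other players, so the variation need not cancel for one
player alone. It does cancel in the sum, leaving only the initial divergences and the cost of the
shift. -/
theorem IsMetaRun.sum_swapReg_le {G : ℕ → Game n d} {m T : ℕ} {η α L : ℝ} {R : Trajectory n d}
    (h : IsMetaRun G m T η α R) (hd : ∀ k, 1 ≤ d k) (hm : 1 ≤ m) (hα0 : 0 < α) (hα1 : α ≤ 1)
    (hη0 : 0 < η) (hη : η ≤ rateBound d L)
    {t : ℕ} (ht : t ∈ Finset.Icc 1 T) (hG : IsLipschitzGame (G t) L)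
    (hu : ∀ i ∈ Finset.Icc 1 m, ∀ (k : Fin n) (b : Fin (d k)),
      |utilVec (G t) k (R.play t i) b| ≤ 1) :
    ∑ k, R.swapReg G m t k ≤
      (1 / η) * ∑ k, ∑ a, bregman (R.shiftedOpt α k a t) (R.init α t k a) + 2 * n * α * m := by
  set C : ℝ := 2 + 2 * n * L ^ 2 with hC
  have hC0 : 0 ≤ C := by positivity
  set M : ℝ := ∑ k, (9 : ℝ) ^ d k with hM
  have hM0 : 0 ≤ M := by positivity
  have hη1 : η * (1 + 32 * C + 1152 * (n * L ^ 2 + C ^ 2) * M) ≤ 1 := by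
    rw [rateBound, le_div_iff₀ (by positivity)] at hη
    exact hη
  have hX : 0 ≤ (n * L ^ 2 + C ^ 2) * M := by positivity
  have hηX : 0 ≤ η * ((n * L ^ 2 + C ^ 2) * M) := by positivity
  have hηC0 : 0 ≤ η * C := by positivity
  have hηC : 32 * η * C ≤ 1 := by linarith
  have hηle : η ≤ 1 := by linarith
  -- The threshold is linear in `η`; the square needed here follows from `η ≤ 1`, which is what its
  -- summand `1` provides.
  have hηM : 1152 * η ^ 2 * ((n * L ^ 2 + C ^ 2) * M) ≤ 1 := by nlinarith
  have hBM := fun k => h.isBMRun hd hm hα0 hα1 ht hG hu k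
  set W : Fin n → ℝ := fun k => ∑ i ∈ Finset.Icc 1 m, ∑ a,
    (bregman (R.sec t i k a) (R.base t i k a) + bregman (R.base t i k a) (R.sec t (i - 1) k a))
    with hW
  set P : ℕ → Fin n → ℝ := fun i k => ∑ b, (R.play t i k b - R.play t (i - 1) k b) ^ 2 with hP
  have hplay : ∀ i ≤ m, ∀ k, R.play t i k ∈ stdSimplex ℝ (Fin (d k)) := fun i hi k =>
    (h.stationary t ht i (Finset.mem_Icc.2 ⟨i.zero_le, hi⟩) k).1
  have hW0 : ∀ k, 0 ≤ W k := by
    intro k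
    refine Finset.sum_nonneg fun i hi => Finset.sum_nonneg fun a _ => ?_
    obtain ⟨-, hi⟩ := Finset.mem_Icc.1 hi
    exact add_nonneg (bregman_nonneg ((hBM k).sec_mem hi a).1 ((hBM k).base_mem hi a).1)
      (bregman_nonneg ((hBM k).base_mem hi a).1 ((hBM k).sec_mem (by omega) a).1)
  have hreg : ∀ k, R.swapReg G m t k ≤
      (1 / η) * ∑ a, bregman (R.shiftedOpt α k a t) (R.init α t k a) +
      6 * η * (L ^ 2 * ∑ i ∈ Finset.Icc 1 m, ∑ j, P i j +
        C ^ 2 * ∑ i ∈ Finset.Icc 1 m, P i k) - 1 / (2 * η) * W k + 2 * α * m := by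
    intro k
    have h1 := swapRegret_le_sum (m := m) (Q := fun i => R.base t i k) (x := fun i => R.play t i k)
      (u := fun i => utilVec (G t) k (R.play t i)) (z := fun a => R.opt t k a)
      (fun i hi => (hBM k).stationary i (Finset.mem_Icc.1 hi).2) (fun a => h.opt t ht k a)
    have h2 := sum_shift_le (m := m) hα0.le (hd k) (Q := fun i => R.base t i k)
      (x := fun i => R.play t i k)
      (u := fun i => utilVec (G t) k (R.play t i)) (z := fun a => R.opt t k a)
      (fun i hi => hplay i (Finset.mem_Icc.1 hi).2 k) (fun i hi => hu i hi k)
      (fun a => (h.opt t ht k a).1)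
    have h3 := (hBM k).regret_le hη0 hηC (z := fun a => R.shiftedOpt α k a t)
      (fun a => h.shiftedOpt_mem hd hα0 hα1 ht k a)
    have h4 : ∑ i ∈ Finset.Icc 1 m, ∑ b, (utilVec (G t) k (R.play t i) b -
        utilVec (G t) k (R.play t (i - 1)) b) ^ 2 ≤
        L ^ 2 * ∑ i ∈ Finset.Icc 1 m, ∑ j, P i j := by
      rw [Finset.mul_sum]
      refine Finset.sum_le_sum fun i hi => ?_
      obtain ⟨-, hi⟩ := Finset.mem_Icc.1 hi
      refine (hG k _ _ (hplay i hi) (hplay (i - 1) (by omega))).trans ?_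
      gcongr
      exact Finset.subset_univ _
    refine (h1.trans h2).trans ?_
    have h5 := mul_le_mul_of_nonneg_left h4 (show 0 ≤ 6 * η by positivity)
    simp only [Trajectory.shiftedOpt] at h3 ⊢
    linarith
  have hpath : ∑ i ∈ Finset.Icc 1 m, ∑ j, P i j ≤ 96 * M * ∑ k, W k := by
    rw [Finset.sum_comm, Finset.mul_sum]
    refine Finset.sum_le_sum fun k _ => ((hBM k).path_le hη0 hηC).trans ?_
    have : (9 : ℝ) ^ d k ≤ M := Finset.single_le_sum (f := fun k => (9 : ℝ) ^ d k)
      (fun k _ => by positivity) (Finset.mem_univ k)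
    have := hW0 k
    gcongr
  have hsum := Finset.sum_le_sum fun k (_ : k ∈ Finset.univ) => hreg k
  simp only [Finset.sum_add_distrib, Finset.sum_sub_distrib, ← Finset.mul_sum] at hsum
  rw [Finset.sum_comm (f := fun k i => P i k)] at hsum
  simp only [Finset.sum_const, Finset.card_univ, Fintype.card_fin, nsmul_eq_mul] at hsum
  have hWs : 0 ≤ ∑ k, W k := Finset.sum_nonneg fun k _ => hW0 k
  -- Summing the Lipschitz bounds over players produces `nL²`. The path bound then requires `6η · 96
  -- ≤ 1/(2η)` up to the remaining factors, hence `1152 = 2 · 6 · 96`.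
  have hcancel : 6 * η * ((n * L ^ 2 + C ^ 2) * ∑ i ∈ Finset.Icc 1 m, ∑ j, P i j) ≤
      1 / (2 * η) * ∑ k, W k := by
    calc _ ≤ 6 * η * ((n * L ^ 2 + C ^ 2) * (96 * M * ∑ k, W k)) := by gcongr
      _ = 1 / (2 * η) * (1152 * η ^ 2 * ((n * L ^ 2 + C ^ 2) * M) * ∑ k, W k) := by
        field_simp
        ring
      _ ≤ 1 / (2 * η) * (1 * ∑ k, W k) := by gcongr
      _ = _ := by rw [one_mul]
  linarith

/-- Swap regret bound, averaged over the tasks and summed over the players. -/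
theorem IsMetaRun.average_sum_swapReg_le {G : ℕ → Game n d} {m T : ℕ} {η α L : ℝ}
    {R : Trajectory n d} (h : IsMetaRun G m T η α R) (hd : ∀ k, 1 ≤ d k) (hm : 1 ≤ m) (hT : 1 ≤ T)
    (hα : α = ((m : ℝ) * (T : ℝ)) ^ (-(1 / 3) : ℝ)) (hη0 : 0 < η) (hη : η ≤ rateBound d L)
    (hG : ∀ t ∈ Finset.Icc 1 T, IsLipschitzGame (G t) L)
    (hu : ∀ t ∈ Finset.Icc 1 T, ∀ i ∈ Finset.Icc 1 m, ∀ (k : Fin n) (b : Fin (d k)),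
      |utilVec (G t) k (R.play t i) b| ≤ 1) :
    (1 / (T : ℝ)) * ∑ t ∈ Finset.Icc 1 T, ∑ k, R.swapReg G m t k ≤ R.regretBound m T η α := by
  have hm' : (1 : ℝ) ≤ m := by exact_mod_cast hm
  have hT' : (1 : ℝ) ≤ T := by exact_mod_cast hT
  have hm0 : (0 : ℝ) < m := by linarith
  have hT0 : (0 : ℝ) < T := by linarith
  have hα0 : 0 < α := by
    rw [hα]
    positivity
  have hα1 : α ≤ 1 := by
    rw [hα]
    exact Real.rpow_le_one_of_one_le_of_nonpos (by nlinarith) (by norm_num)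
  set F : ℝ := (m : ℝ) ^ (2 / 3 : ℝ) / (T : ℝ) ^ (1 / 3 : ℝ) with hF
  -- Both error sources take the common size `F`: the shift costs a multiple of `α m`, and the
  -- average initialization loss per task is proportional to `1/(α² T)`.
  have hF1 : α * m = F := by
    rw [hα, Real.mul_rpow hm0.le hT0.le, hF, Real.rpow_neg hT0.le, mul_right_comm,
      ← div_eq_mul_inv]
    congr 1
    nth_rewrite 2 [← Real.rpow_one (m : ℝ)]
    rw [← Real.rpow_add hm0]
    norm_num
  have hF2 : 1 / α ^ 2 = T * F := by
    have h3 : α ^ 3 = 1 / (m * T) := by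
      rw [hα, ← Real.rpow_natCast, ← Real.rpow_mul (by positivity)]
      norm_num
      rw [Real.rpow_neg_one, mul_inv, mul_comm]
    rw [← hF1, div_eq_iff (by positivity)]
    have : (T : ℝ) * (α * m) * α ^ 2 = α ^ 3 * (m * T) := by ring
    rw [this, h3]
    field_simp
  have hF0 : 0 < F := by positivity
  have hlog : 0 ≤ Real.log T := Real.log_nonneg hT'
  have h1 := Finset.sum_le_sum fun t ht => h.sum_swapReg_le hd hm hα0 hα1 hη0 hη ht (hG t ht)
    (hu t ht)
  have h2 : ∀ (k : Fin n) (a : Fin (d k)),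
      ∑ t ∈ Finset.Icc 1 T, bregman (R.shiftedOpt α k a t) (R.init α t k a) ≤
      T * R.similarity T α k a + T * (F * (8 * (d k : ℝ) ^ 2 * (1 + Real.log T))) := by
    intro k a
    have h3 := sum_bregman_followAverage_le (T := T) (hd k) hα0 hα1 (z := R.shiftedOpt α k a)
      (fun s hs => h.shiftedOpt_mem hd hα0 hα1 hs k a)
      (fun s hs b => le_shift hα1 (h.opt s hs k a).1 b)
    refine h3.trans ?_
    have e1 : (T : ℝ) * R.similarity T α k a = ∑ t ∈ Finset.Icc 1 T,
        bregman (R.shiftedOpt α k a t) (average T (R.shiftedOpt α k a)) := by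
      rw [Trajectory.similarity, ← mul_assoc, mul_one_div_cancel hT0.ne', one_mul]
    have e2 : 4 * (d k : ℝ) ^ 2 / α ^ 2 = 4 * (d k : ℝ) ^ 2 * (T * F) := by
      rw [← hF2, mul_one_div]
    rw [e1, e2]
    -- The argument yields the coefficient `4`; this nonnegative term fills the slack up to `8`.
    have : 0 ≤ T * (F * ((d k : ℝ) ^ 2 * (1 + Real.log T))) := by positivity
    linarith
  have h4 : ∑ t ∈ Finset.Icc 1 T, ∑ k, ∑ a,
      bregman (R.shiftedOpt α k a t) (R.init α t k a) ≤
      T * (∑ k, ∑ a, R.similarity T α k a) +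
        T * (F * ∑ k, 8 * (d k : ℝ) ^ 3 * (1 + Real.log T)) := by
    rw [Finset.sum_comm]
    simp only [Finset.mul_sum]
    rw [← Finset.sum_add_distrib]
    refine Finset.sum_le_sum fun k _ => ?_
    rw [Finset.sum_comm]
    refine (Finset.sum_le_sum fun a _ => h2 k a).trans_eq ?_
    rw [Finset.sum_add_distrib]
    simp only [Finset.sum_const, Finset.card_univ, Fintype.card_fin, nsmul_eq_mul]
    ring
  rw [Finset.sum_add_distrib, ← Finset.mul_sum] at h1
  simp only [Finset.sum_const, Nat.card_Icc, Nat.add_sub_cancel, nsmul_eq_mul] at h1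
  rw [one_div, inv_mul_le_iff₀ hT0, Trajectory.regretBound, ← hF, ← Finset.sum_div]
  have h5 := mul_le_mul_of_nonneg_left h4 (show 0 ≤ 1 / η by positivity)
  refine h1.trans ((add_le_add_left h5 _).trans_eq ?_)
  rw [← hF1]
  ring

end MetaSwap

theorem mainTheorem9 (n : ℕ) (d : Fin n → ℕ) (hd : ∀ k, 1 ≤ d k) (L : ℝ) (hL : 0 < L) :
    ∃ η₀ : ℝ, 0 < η₀ ∧ ∀ η : ℝ, 0 < η → η ≤ η₀ →
      ∀ (m T : ℕ), 1 ≤ m → 1 ≤ T →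
      ∀ (G : ℕ → MetaSwap.Game n d), (∀ t ∈ Finset.Icc 1 T, MetaSwap.IsLipschitzGame (G t) L) →
      ∀ (α : ℝ), α = ((m : ℝ) * (T : ℝ)) ^ (-(1 / 3) : ℝ) →
      ∀ (R : MetaSwap.Trajectory n d), MetaSwap.IsMetaRun G m T η α R →
        (∀ t ∈ Finset.Icc 1 T, ∀ i ∈ Finset.Icc 1 m, ∀ (k : Fin n) (b : Fin (d k)),
          |MetaSwap.utilVec (G t) k (R.play t i) b| ≤ 1) →
        (∀ k : Fin n,
          (1 / (T : ℝ)) * ∑ t ∈ Finset.Icc 1 T, R.swapReg G m t k ≤ R.regretBound m T η α) ∧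
        ∃ ε : ℕ → ℝ,
          (∀ t ∈ Finset.Icc 1 T,
            MetaSwap.IsApproxCE (G t) (ε t) (MetaSwap.avgPlay m (R.play t))) ∧
          (1 / (T : ℝ)) * ∑ t ∈ Finset.Icc 1 T, ε t ≤ (1 / (m : ℝ)) * R.regretBound m T η α := by
  refine ⟨MetaSwap.rateBound d L, MetaSwap.rateBound_pos d L, ?_⟩
  intro η hη0 hη m T hm hT G hG α hα R h hu
  have hmain := h.average_sum_swapReg_le hd hm hT hα hη0 hη hG hu
  have hle : ∀ t ∈ Finset.Icc 1 T, ∀ k, R.swapReg G m t k ≤ ∑ j, R.swapReg G m t j :=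
    fun t ht k => Finset.single_le_sum (f := fun j => R.swapReg G m t j)
      (fun j _ => h.swapReg_nonneg ht j) (Finset.mem_univ k)
  -- Taking `ε t` from the sum of the swap regrets, which dominates each of them, lets one bound
  -- serve all players at once.
  refine ⟨fun k => ?_, fun t => 1 / (m : ℝ) * ∑ k, R.swapReg G m t k, fun t ht => ?_, ?_⟩
  · refine le_trans ?_ hmain
    gcongr with t ht
    exact hle t ht k
  · refine MetaSwap.isApproxCE_avgPlay hm (fun i hi k => ?_) fun k => ?_
    · exact (h.stationary t ht i
        (Finset.mem_Icc.2 ⟨i.zero_le, (Finset.mem_Icc.1 hi).2⟩) k).1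
    · exact mul_le_mul_of_nonneg_left (hle t ht k) (by positivity)
  · rw [← Finset.mul_sum, mul_left_comm]
    exact mul_le_mul_of_nonneg_left hmain (by positivity)
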